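/- Let $d\ge 0$ and let $C^1_b=C^1_b(\mathbf R^d,\mathbf R^d)$ be the Banach space of bounded $C^1$ vector fields with bounded derivative, with the $C^1$-norm. Let $\mathcal F(C^1_b)$ be the Micheletti group of all bijections $F=\mathrm{id}+f$ of $\mathbf R^d$ with $f\in C^1_b$ and $F^{-1}-\mathrm{id}\in C^1_b$, under composition, with the Banach manifold structure given by the charts $\varphi_F(F')=F'-F\in C^1_b$. For an open set $\Omega\subset\mathbf R^d$ let $\mathcal G(\Omega)=\{F\in\mathcal F(C^1_b): F(\Omega)=\Omega\}$, let $\mathcal F(C^1_b)/\mathcal G(\Omega)$ be the set of cosets $[F]=F\circ\mathcal G(\Omega)$ with the quotient topology, and call a real function $f$ on an open subset of the quotient smooth if $F\mapsto f([F])$ is $C^\infty$. The tangent space $T_{[F]}(\mathcal F(C^1_b)/\mathcal G(\Omega))$ is the set of classes $\langle\gamma\rangle$ of $C^1$ curves $\gamma:(-\delta,\varepsilon)\to\mathcal F(C^1_b)$ $(\delta,\varepsilon>0)$ with $[\gamma(0)]=[F]$, where $\gamma_1,\gamma_2$ are equivalent if $\frac{d}{dt}f([\gamma_1(t)])|_{t=0}=\frac{d}{dt}f([\gamma_2(t)])|_{t=0}$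 for all functions $f$ that are defined and smooth on an open neighbourhood of $[F]$; write $\langle\gamma\rangle f$ for this derivative. **Lemma.** Let $\Omega\subset\mathbf R^d$ be a $C^1$-domain (an open set lying locally on one side of its $C^1$ boundary; it need not be connected) with compact boundary. Let $F\in\mathcal F(C^1_b)$ and let $\nu_F$ be the outward unit normal field of $F(\Omega)$ along $F(\partial\Omega)$. Then: 1. There is a bijection $$T_{[F]}(\mathcal F(C^1_b)/\mathcal G(\Omega))\;\longrightarrow\; C^1_b/\!\sim,\qquad X\sim\tilde X \iff (X\circ F^{-1})\cdot\nu_F=(\tilde X\circ F^{-1})\cdot\nu_F\ \text{ on } F(\partial\Omega),$$ that sends $\langle\gamma\rangle$ to the class of $\frac{d}{dt}\varphi_F(\gamma(t))|_{t=0}$ for every curve $\gamma$ with $\gamma(0)=F$. It is linear in the following sense: if $u,v,w$ are tangent vectors whose images satisfy $[U]=a[V]+b[W]$ with $a,b\in\mathbf R$, then $uf=a\,vf+b\,wf$ for every function $f$ that is smooth near $[F]$. 2. The map $[X]\mapsto[X\circ F^{-1}]$ is a well-defined linear isomorphism from $C^1_b/\!\sim$ onto the space of classes of $X\in C^1_b$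 under the relation $X\approx\tilde X\iff X\cdot\nu_F=\tilde X\cdot\nu_F$ on $F(\partial\Omega)$. -/

import Mathlib

open scoped ContDiff BoundedContinuousFunction

namespace ShapeGroup

noncomputable section

/-- The Euclidean space `ℝ^d`. -/
abbrev E (d : ℕ) : Type := EuclideanSpace ℝ (Fin d)

/-- Pairs of a bounded continuous field `f` and a bounded continuous operator field `A`, with the
norm `max (sup ‖f‖) (sup ‖A‖)`. -/
def FieldPair (d : ℕ) : Type := (E d →ᵇ E d) × (E d →ᵇ (E d →L[ℝ] E d))

instance (d : ℕ) : NormedAddCommGroup (FieldPair d) :=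
  inferInstanceAs (NormedAddCommGroup ((E d →ᵇ E d) × (E d →ᵇ (E d →L[ℝ] E d))))

instance (d : ℕ) : NormedSpace ℝ (FieldPair d) :=
  inferInstanceAs (NormedSpace ℝ ((E d →ᵇ E d) × (E d →ᵇ (E d →L[ℝ] E d))))

/-- The Banach space `C^1_b(ℝ^d, ℝ^d)` of bounded `C^1` vector fields with bounded derivative.
A field `f` is stored together with its derivative, as the pair `(f, Df)` of bounded continuous
functions; the norm is `max (sup ‖f‖) (sup ‖Df‖)`, a standard `C^1` norm. -/
def C1b (d : ℕ) : Submodule ℝ (FieldPair d) where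
  carrier := {p | ∀ x, HasFDerivAt p.1 (p.2 x) x}
  add_mem' := fun ha hb x => (ha x).add (hb x)
  zero_mem' := fun x => hasFDerivAt_const (0 : E d) x
  smul_mem' := fun c _ ha x => (ha x).const_smul c

instance (d : ℕ) : CoeFun (C1b d) (fun _ => E d → E d) := ⟨fun f => f.1.1⟩

theorem C1b.ext {d : ℕ} {f g : C1b d} (h : ∀ x, f x = g x) : f = g := by
  have h1 : f.1.1 = g.1.1 := BoundedContinuousFunction.ext h
  apply Subtype.ext
  refine Prod.ext h1 (BoundedContinuousFunction.ext fun x => ?_)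
  have hf := f.2 x
  have hg := g.2 x
  rw [h1] at hf
  exact hf.unique hg

/-- If `id + g` is a transformation with `g ∈ C^1_b`, then `f ∘ (id + g) ∈ C^1_b`. -/
theorem C1b.exists_comp {d : ℕ} (f g : C1b d) : ∃ k : C1b d, ∀ x, k x = f (x + g x) := by
  have hc : Continuous fun x : E d => x + g x := continuous_id.add g.1.1.continuous
  let k1 : E d →ᵇ E d :=
    BoundedContinuousFunction.ofNormedAddCommGroup (fun x => f (x + g x))
      (f.1.1.continuous.comp hc) ‖f.1.1‖ (fun x => f.1.1.norm_coe_le_norm _)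
  let k2 : E d →ᵇ (E d →L[ℝ] E d) :=
    BoundedContinuousFunction.ofNormedAddCommGroup
      (fun x => (f.1.2 (x + g x)).comp (ContinuousLinearMap.id ℝ (E d) + g.1.2 x))
      ((f.1.2.continuous.comp hc).clm_comp (continuous_const.add g.1.2.continuous))
      (‖f.1.2‖ * (1 + ‖g.1.2‖)) (fun x => by
        refine (ContinuousLinearMap.opNorm_comp_le _ _).trans ?_
        refine mul_le_mul (f.1.2.norm_coe_le_norm _) ?_ (norm_nonneg _) (norm_nonneg f.1.2)
        exact (norm_add_le _ _).trans
          (add_le_add ContinuousLinearMap.norm_id_le (g.1.2.norm_coe_le_norm _)))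
  refine ⟨⟨(k1, k2), fun x => ?_⟩, fun x => rfl⟩
  have h : HasFDerivAt (fun y : E d => y + g y)
      (ContinuousLinearMap.id ℝ (E d) + g.1.2 x) x := (hasFDerivAt_id x).add (g.2 x)
  exact HasFDerivAt.comp (g := f.1.1) x (f.2 (x + g x)) h

/-- `F` has the form `id + f` with `f ∈ C^1_b`. -/
def IsIdAdd {d : ℕ} (F : E d → E d) : Prop := ∃ f : C1b d, ∀ x, F x = x + f x

theorem IsIdAdd.comp {d : ℕ} {F G : E d → E d} (hF : IsIdAdd F) (hG : IsIdAdd G) :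
    IsIdAdd (F ∘ G) := by
  obtain ⟨f, hf⟩ := hF
  obtain ⟨g, hg⟩ := hG
  obtain ⟨k, hk⟩ := C1b.exists_comp f g
  refine ⟨g + k, fun x => ?_⟩
  have h : (g + k : C1b d) x = g x + k x := rfl
  rw [h, hk, Function.comp_apply, hf, hg, add_assoc]

/-- The Micheletti group as a group of bijections of `ℝ^d`: all bijections `F = id + f` with
`f ∈ C^1_b` and `F⁻¹ = id + g` with `g ∈ C^1_b`, under composition. -/
def michelettiSubgroup (d : ℕ) : Subgroup (Equiv.Perm (E d)) where
  carrier := {F | IsIdAdd F ∧ IsIdAdd F.symm}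
  mul_mem' := fun {_ _} ha hb => ⟨ha.1.comp hb.1, hb.2.comp ha.2⟩
  one_mem' := ⟨⟨0, fun x => (add_zero x).symm⟩, ⟨0, fun x => (add_zero x).symm⟩⟩
  inv_mem' := fun {_} ha => ⟨ha.2, ha.1⟩

/-- The Micheletti group `𝓕(C^1_b)`. -/
def Micheletti (d : ℕ) : Type := michelettiSubgroup d

instance (d : ℕ) : Group (Micheletti d) := inferInstanceAs (Group (michelettiSubgroup d))

instance (d : ℕ) : CoeFun (Micheletti d) (fun _ => E d → E d) := ⟨fun F => F.1⟩

/-- The field `F - id ∈ C^1_b` of an element `F` of the Micheletti group. -/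
def dev {d : ℕ} (F : Micheletti d) : C1b d := F.2.1.choose

theorem apply_eq_add_dev {d : ℕ} (F : Micheletti d) (x : E d) : F x = x + dev F x :=
  F.2.1.choose_spec x

/-- The chart `φ_F : F' ↦ F' - F ∈ C^1_b` of the Banach manifold `𝓕(C^1_b)` centred at `F`. -/
def chart {d : ℕ} (F F' : Micheletti d) : C1b d := dev F' - dev F

open Classical in
/-- The parametrization `ψ_F : h ↦ F + h`, the inverse of the chart `φ_F`. It takes the dummy
value `F` at those `h` for which `F + h` is not in the group. -/
def param {d : ℕ} (F : Micheletti d) (h : C1b d) : Micheletti d :=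
  if H : ∃ F' : Micheletti d, ∀ x, F' x = F x + h x then H.choose else F

theorem param_chart {d : ℕ} (F F' : Micheletti d) : param F (chart F F') = F' := by
  have key : ∀ x, F' x = F x + chart F F' x := fun x => by
    have h : chart F F' x = dev F' x - dev F x := rfl
    rw [h, apply_eq_add_dev, apply_eq_add_dev]
    abel
  have H : ∃ G : Micheletti d, ∀ x, G x = F x + chart F F' x := ⟨F', key⟩
  rw [param, dif_pos H]
  apply Subtype.ext
  apply Equiv.ext
  intro x
  exact (H.choose_spec x).trans (key x).symm

/-- The topology of the manifold `𝓕(C^1_b)`: `F' → F` iff `F' - F → 0` in `C^1_b`. -/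
instance (d : ℕ) : TopologicalSpace (Micheletti d) := TopologicalSpace.induced dev inferInstance

/-- The subgroup `𝓖(Ω) = {F : F(Ω) = Ω}`. -/
def stab {d : ℕ} (Ω : Set (E d)) : Subgroup (Micheletti d) where
  carrier := {F | F '' Ω = Ω}
  mul_mem' := fun {a b} (ha : a '' Ω = Ω) (hb : b '' Ω = Ω) => by
    change (a ∘ b) '' Ω = Ω
    rw [Set.image_comp, hb, ha]
  one_mem' := Set.image_id Ω
  inv_mem' := fun {a} (ha : a '' Ω = Ω) => by
    change a.1.symm '' Ω = Ω
    conv_lhs => rw [← ha]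
    exact a.1.symm_image_image Ω

/-- The quotient `𝓕(C^1_b) / 𝓖(Ω)` (the cosets `F ∘ 𝓖(Ω)`), with the quotient topology. -/
abbrev ShapeQuotient {d : ℕ} (Ω : Set (E d)) : Type := Micheletti d ⧸ stab Ω

/-- The projection `F ↦ [F]`. -/
abbrev proj {d : ℕ} (Ω : Set (E d)) (F : Micheletti d) : ShapeQuotient Ω := QuotientGroup.mk F

/-- Real functions that are defined and `C^∞` on an open set `dom` of the quotient containing `p`:
`F ↦ f [F]` is `C^∞` on the open set `{F | [F] ∈ dom}` of `𝓕(C^1_b)`, that is, in every chart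
`φ_F`. (The values of `toFun` outside `dom` are dummies.) -/
structure SmoothFunAt {d : ℕ} (Ω : Set (E d)) (p : ShapeQuotient Ω) where
  dom : Set (ShapeQuotient Ω)
  toFun : ShapeQuotient Ω → ℝ
  isOpen_dom : IsOpen dom
  mem_dom : p ∈ dom
  smooth : ∀ F : Micheletti d,
    ContDiffOn ℝ ∞ (fun h : C1b d => toFun (proj Ω (param F h))) (chart F '' (proj Ω ⁻¹' dom))

/-- `C^1` curves `γ : (-δ, ε) → 𝓕(C^1_b)` whose projection to the quotient passes through `p` at
time `0`. (The values of `toFun` outside `(-δ, ε)` are dummies.) -/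
structure CurveAt {d : ℕ} (Ω : Set (E d)) (p : ShapeQuotient Ω) where
  toFun : ℝ → Micheletti d
  δ : ℝ
  ε : ℝ
  δ_pos : 0 < δ
  ε_pos : 0 < ε
  contDiff : ContDiffOn ℝ 1 (fun t => chart (toFun 0) (toFun t)) (Set.Ioo (-δ) ε)
  proj_zero : proj Ω (toFun 0) = p

/-- The derivative `d/dt f([γ(t)])` at `t = 0`. -/
def CurveAt.derivAlong {d : ℕ} {Ω : Set (E d)} {p : ShapeQuotient Ω} (γ : CurveAt Ω p)
    (f : SmoothFunAt Ω p) : ℝ :=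
  deriv (fun t => f.toFun (proj Ω (γ.toFun t))) 0

/-- The velocity `d/dt φ_{γ(0)}(γ(t))` at `t = 0`, an element of `C^1_b`. -/
def CurveAt.velocity {d : ℕ} {Ω : Set (E d)} {p : ShapeQuotient Ω} (γ : CurveAt Ω p) : C1b d :=
  deriv (fun t => chart (γ.toFun 0) (γ.toFun t)) 0

/-- Two curves through `p` are equivalent iff all smooth functions on the quotient near `p` have
the same derivative along them at time `0`. -/
def curveSetoid {d : ℕ} (Ω : Set (E d)) (p : ShapeQuotient Ω) : Setoid (CurveAt Ω p) where
  r γ₁ γ₂ := ∀ f : SmoothFunAt Ω p, γ₁.derivAlong f = γ₂.derivAlong f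
  iseqv := { refl := fun _ _ => rfl
             symm := fun {_ _} h f => (h f).symm
             trans := fun {_ _ _} h₁ h₂ f => (h₁ f).trans (h₂ f) }

/-- The tangent space of `𝓕(C^1_b) / 𝓖(Ω)` at `p`. -/
def QuotientTangent {d : ℕ} (Ω : Set (E d)) (p : ShapeQuotient Ω) : Type :=
  Quotient (curveSetoid Ω p)

/-- The class `⟨γ⟩` of a curve. -/
def CurveAt.tangent {d : ℕ} {Ω : Set (E d)} {p : ShapeQuotient Ω} (γ : CurveAt Ω p) :
    QuotientTangent Ω p :=
  Quotient.mk (curveSetoid Ω p) γ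

/-- The action of a tangent vector on smooth functions, `⟨γ⟩ f = d/dt f([γ(t)])` at `t = 0`. By the
definition of the tangent space, a tangent vector is determined by this action, and the linear
operations on tangent vectors are those of their actions. -/
def QuotientTangent.act {d : ℕ} {Ω : Set (E d)} {p : ShapeQuotient Ω} (v : QuotientTangent Ω p)
    (f : SmoothFunAt Ω p) : ℝ :=
  Quotient.lift (fun γ : CurveAt Ω p => γ.derivAlong f)
    (fun _ _ (h : ∀ _ : SmoothFunAt Ω p, _ = _) => h f) v

/-- `ρ` is a `C^1` defining function of `Ω` on the open neighbourhood `U` of the boundary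
point `p`: it has no critical point in `U`, and `Ω` is `{ρ < 0}` within `U`. -/
structure IsDefiningFunction {d : ℕ} (Ω : Set (E d)) (p : E d) (U : Set (E d)) (ρ : E d → ℝ) :
    Prop where
  isOpen : IsOpen U
  mem : p ∈ U
  contDiffOn : ContDiffOn ℝ 1 ρ U
  gradient_ne_zero : ∀ x ∈ U, gradient ρ x ≠ 0
  apply_eq_zero : ρ p = 0
  inter_eq : Ω ∩ U = {x ∈ U | ρ x < 0}

/-- `C^1` domains: open sets that lie near each boundary point on one side of a `C^1`
hypersurface. (Connectedness is not required.) -/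
structure IsC1Domain {d : ℕ} (Ω : Set (E d)) : Prop where
  isOpen : IsOpen Ω
  exists_defining : ∀ p ∈ frontier Ω, ∃ U ρ, IsDefiningFunction Ω p U ρ

open Classical in
/-- The outward unit normal `∇ρ / |∇ρ|` of `Ω` at the boundary point `p`, for a defining
function `ρ` of `Ω` near `p` (the choice of `ρ` does not matter). -/
def outerNormal {d : ℕ} (Ω : Set (E d)) (p : E d) : E d :=
  if H : ∃ ρ : E d → ℝ, ∃ U, IsDefiningFunction Ω p U ρ then
    ‖gradient H.choose p‖⁻¹ • gradient H.choose p
  else 0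

/-- The fields `X ∈ C^1_b` with `(X ∘ F⁻¹) · ν_F = 0` on `F(∂Ω)`, where `ν_F` is the outward unit
normal of `F(Ω)`. -/
def tangentialPullback {d : ℕ} (Ω : Set (E d)) (F : Micheletti d) : Submodule ℝ (C1b d) where
  carrier := {X | ∀ y ∈ F '' frontier Ω, inner ℝ (X (F⁻¹ y)) (outerNormal (F '' Ω) y) = 0}
  add_mem' := fun {a b} ha hb y hy => by
    change inner ℝ (a (F⁻¹ y) + b (F⁻¹ y)) (outerNormal (F '' Ω) y) = 0
    rw [inner_add_left, ha y hy, hb y hy, add_zero]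
  zero_mem' := fun y _ => inner_zero_left _
  smul_mem' := fun c a ha y hy => by
    change inner ℝ (c • a (F⁻¹ y)) (outerNormal (F '' Ω) y) = 0
    rw [real_inner_smul_left, ha y hy, mul_zero]

/-- The fields `X ∈ C^1_b` with `X · ν_F = 0` on `F(∂Ω)`. -/
def tangentialFields {d : ℕ} (Ω : Set (E d)) (F : Micheletti d) : Submodule ℝ (C1b d) where
  carrier := {X | ∀ y ∈ F '' frontier Ω, inner ℝ (X y) (outerNormal (F '' Ω) y) = 0}
  add_mem' := fun {a b} ha hb y hy => by
    change inner ℝ (a y + b y) (outerNormal (F '' Ω) y) = 0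
    rw [inner_add_left, ha y hy, hb y hy, add_zero]
  zero_mem' := fun y _ => inner_zero_left _
  smul_mem' := fun c a ha y hy => by
    change inner ℝ (c • a y) (outerNormal (F '' Ω) y) = 0
    rw [real_inner_smul_left, ha y hy, mul_zero]

/-- `C^1_b` modulo `X ~ X'` iff `(X ∘ F⁻¹) · ν_F = (X' ∘ F⁻¹) · ν_F` on `F(∂Ω)`. -/
abbrev PullbackNormalClasses {d : ℕ} (Ω : Set (E d)) (F : Micheletti d) : Type :=
  C1b d ⧸ tangentialPullback Ω F

/-- `C^1_b` modulo `X ~ X'` iff `X · ν_F = X' · ν_F` on `F(∂Ω)`. -/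
abbrev NormalClasses {d : ℕ} (Ω : Set (E d)) (F : Micheletti d) : Type :=
  C1b d ⧸ tangentialFields Ω F

/-- The class of `X` in `PullbackNormalClasses`. -/
def pullbackClass {d : ℕ} (Ω : Set (E d)) (F : Micheletti d) (X : C1b d) :
    PullbackNormalClasses Ω F :=
  (tangentialPullback Ω F).mkQ X

/-- The class of `X` in `NormalClasses`. -/
def normalClass {d : ℕ} (Ω : Set (E d)) (F : Micheletti d) (X : C1b d) : NormalClasses Ω F :=
  (tangentialFields Ω F).mkQ X

theorem pullbackClass_eq_iff {d : ℕ} (Ω : Set (E d)) (F : Micheletti d) (X X' : C1b d) :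
    pullbackClass Ω F X = pullbackClass Ω F X' ↔ ∀ y ∈ F '' frontier Ω,
      inner ℝ (X (F⁻¹ y)) (outerNormal (F '' Ω) y) =
        inner ℝ (X' (F⁻¹ y)) (outerNormal (F '' Ω) y) := by
  refine (Submodule.Quotient.eq _).trans (forall₂_congr fun y _ => ?_)
  change inner ℝ (X (F⁻¹ y) - X' (F⁻¹ y)) (outerNormal (F '' Ω) y) = 0 ↔ _
  rw [inner_sub_left, sub_eq_zero]

theorem normalClass_eq_iff {d : ℕ} (Ω : Set (E d)) (F : Micheletti d) (X X' : C1b d) :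
    normalClass Ω F X = normalClass Ω F X' ↔ ∀ y ∈ F '' frontier Ω,
      inner ℝ (X y) (outerNormal (F '' Ω) y) = inner ℝ (X' y) (outerNormal (F '' Ω) y) := by
  refine (Submodule.Quotient.eq _).trans (forall₂_congr fun y _ => ?_)
  change inner ℝ (X y - X' y) (outerNormal (F '' Ω) y) = 0 ↔ _
  rw [inner_sub_left, sub_eq_zero]

end

end ShapeGroup

/-! Write `S = F(Ω)`. By the chain rule a curve through `F` with velocity `X` acts on `f` as
`differential F f X`. A curve through another representative `F ∘ g` can be moved to `F`, because
right translation by `g` is a bounded linear map in the charts (`differential_mul`). So the tangent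
space is `C^1_b` modulo the common kernel of all differentials, and the whole theorem rests on
identifying that kernel with the fields `X` for which `Y = X ∘ F⁻¹` is tangential to `∂S`
(`mem_tangentialPullback_iff`).

Tangential fields are annihilated. If `G_t(S) = S`, then `f` is constant along `G_t ∘ F`. The flow
of `Y` is the natural choice of `G_t`, but it need not be differentiable in the `C^1` norm when `DY`
is not uniformly continuous. Compactness of the boundary gives a way out: `Y = Z + (Y - Z)`, where
`Z` is `Y` times a cutoff. The flow of `Z` is differentiable at time zero (`exists_flow`) and
preserves `S` by Nagumo's theorem. The field `Y - Z` vanishes on `∂S`, so the maps `id + t(Y - Z)`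
preserve `S` for small `t` and no flow is needed.

Other fields are detected. The functions `[F] ↦ ∫_{F(Ω)} φ` are smooth: a change of variables turns
them into a superposition operator followed by an integral over a compact set. No surface integral
is used to show that a suitable derivative is nonzero. If `Y` points outward at `p ∈ ∂S`, compare it
with a constant field `e` that points outward less strongly. Near `p` the set moved by `Y` contains
the translate of `S` by `te`, so for `φ ≥ 0` supported near `p` the derivative along `X` is at least
the derivative along `e`. For translations the mean value theorem supplies a `φ` with positive
derivative: `s ↦ ∫_S φ(y + se)` is zero at `-s₀`, where the bump lies outside `S`, and positive at
`s₀`, where it lies inside. -/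

namespace ShapeGroup

open Set Filter Topology

/-! ### Superposition operators and inverses of perturbed identities in Banach spaces. -/

/-- Pointwise application of an operator field to a vector field, on a compact space. -/
noncomputable def pointwiseApply (X : Type*) [TopologicalSpace X] [CompactSpace X]
    (V W : Type*) [NormedAddCommGroup V] [NormedSpace ℝ V]
    [NormedAddCommGroup W] [NormedSpace ℝ W] :
    C(X, V →L[ℝ] W) →L[ℝ] C(X, V) →L[ℝ] C(X, W) :=
  LinearMap.mkContinuous₂
    (LinearMap.mk₂ ℝ (fun (A : C(X, V →L[ℝ] W)) (c : C(X, V)) =>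
        (⟨fun x => A x (c x), A.continuous.clm_apply c.continuous⟩ : C(X, W)))
      (fun _ _ _ => rfl) (fun _ _ _ => rfl)
      (fun A c c' => ContinuousMap.ext fun x => (A x).map_add (c x) (c' x))
      (fun r A c => ContinuousMap.ext fun x => (A x).map_smul r (c x))) 1 (fun A c => by
        rw [one_mul]
        refine (ContinuousMap.norm_le _ (by positivity)).2 fun x => ?_
        exact (A x).le_of_opNorm_le_of_le (A.norm_coe_le_norm x) (c.norm_coe_le_norm x))

section Superposition

variable {X : Type*} [TopologicalSpace X] [CompactSpace X]

/-- The range of `c` is compact, so `φ'` is continuous there with one modulus valid for all its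
points, even against points off the range. The mean value inequality on a ball around each `c x`
then gives a remainder uniform in `x`. -/
theorem hasFDerivAt_superposition {V W : Type*} [NormedAddCommGroup V] [NormedSpace ℝ V]
    [NormedAddCommGroup W] [NormedSpace ℝ W] (φ : C(V, W)) (φ' : C(V, V →L[ℝ] W))
    (h : ∀ v, HasFDerivAt φ (φ' v) v) (c : C(X, V)) :
    HasFDerivAt (fun c : C(X, V) => φ.comp c) (pointwiseApply X V W (φ'.comp c)) c := by
  rw [hasFDerivAt_iff_isLittleO_nhds_zero, Asymptotics.isLittleO_iff]
  intro ε hε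
  have hK : IsCompact (range c) := isCompact_range c.continuous
  have hu := hK.uniformContinuousAt_of_continuousAt φ'
    (fun a _ => φ'.continuous.continuousAt) (Metric.dist_mem_uniformity hε)
  obtain ⟨δ, hδ, hu⟩ := Metric.mem_uniformity_dist.1 hu
  filter_upwards [Metric.ball_mem_nhds (0 : C(X, V)) hδ] with k hk
  rw [mem_ball_zero_iff] at hk
  refine (ContinuousMap.norm_le _ (by positivity)).2 fun x => ?_
  have hkx : ‖k x‖ ≤ ‖k‖ := k.norm_coe_le_norm x
  have hmv := (convex_ball (c x) δ).norm_image_sub_le_of_norm_hasFDerivWithin_le'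
    (f := φ) (f' := φ') (φ := φ' (c x)) (C := ε) (x := c x) (y := c x + k x)
    (fun y _ => (h y).hasFDerivWithinAt) (fun y hy => ?_) (Metric.mem_ball_self hδ)
    (by simpa using hkx.trans_lt hk)
  · rw [add_sub_cancel_left] at hmv
    change ‖φ (c x + k x) - φ (c x) - φ' (c x) (k x)‖ ≤ ε * ‖k‖
    exact hmv.trans (mul_le_mul_of_nonneg_left hkx hε.le)
  · have := hu (a := c x) (b := y) (by rw [dist_comm]; exact hy) ⟨x, rfl⟩
    rw [← dist_eq_norm, dist_comm]
    exact le_of_lt this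

/-- The derivative is superposition with `fderiv ℝ φ` followed by a bounded linear map, so induction
applies. The target `W` is quantified inside because differentiation replaces it by `V →L[ℝ] W`. -/
theorem contDiff_superposition_nat {V : Type} [NormedAddCommGroup V] [NormedSpace ℝ V] (n : ℕ) :
    ∀ {W : Type} [NormedAddCommGroup W] [NormedSpace ℝ W] (φ : C(V, W)),
      ContDiff ℝ ∞ φ → ContDiff ℝ n (fun c : C(X, V) => φ.comp c) := by
  induction n with
  | zero =>
    intro W _ _ φ _
    exact contDiff_zero.2 (ContinuousMap.continuous_postcomp φ)
  | succ n ih =>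
    intro W _ _ φ hφ
    have hd : ContDiff ℝ ∞ (fderiv ℝ φ) := hφ.fderiv_right (by simp)
    let φ' : C(V, V →L[ℝ] W) := ⟨fderiv ℝ φ, hd.continuous⟩
    have h : ∀ v, HasFDerivAt φ (φ' v) v := fun v =>
      ((hφ.differentiable (by simp)) v).hasFDerivAt
    rw [Nat.cast_succ, contDiff_succ_iff_hasFDerivAt]
    refine ⟨fun c => pointwiseApply X V W (φ'.comp c), ?_, fun c =>
      hasFDerivAt_superposition φ φ' h c⟩
    exact (pointwiseApply X V W).contDiff.comp (ih φ' hd)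

theorem contDiff_superposition {V W : Type} [NormedAddCommGroup V] [NormedSpace ℝ V]
    [NormedAddCommGroup W] [NormedSpace ℝ W] (φ : C(V, W)) (hφ : ContDiff ℝ ∞ φ) :
    ContDiff ℝ ∞ (fun c : C(X, V) => φ.comp c) :=
  contDiff_infty.2 fun n => contDiff_superposition_nat n φ hφ

end Superposition

/-- A perturbation `id - N` of the identity of a Banach space by a `C^1` contraction has a `C^1`
inverse. -/
theorem exists_inverse_id_sub {P : Type*} [NormedAddCommGroup P] [NormedSpace ℝ P]
    [CompleteSpace P] (N : P → P) (N' : P → P →L[ℝ] P) {q : ℝ} (hq : q < 1)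
    (hN : ∀ c, HasFDerivAt N (N' c) c) (hN' : Continuous N') (hb : ∀ c, ‖N' c‖ ≤ q) :
    ∃ (S : P → P) (S' : P → P →L[ℝ] P), (∀ y, S y = y + N (S y)) ∧ (∀ c, S (c - N c) = c) ∧
      Continuous S' ∧ (∀ y, HasFDerivAt S (S' y) y) ∧
      ∀ y, S' y = ContinuousLinearMap.id ℝ P + (N' (S y)).comp (S' y) := by
  have hq0 : 0 ≤ q := (norm_nonneg _).trans (hb 0)
  have hlip : ∀ a b, ‖N a - N b‖ ≤ q * ‖a - b‖ := fun a b =>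
    convex_univ.norm_image_sub_le_of_norm_hasFDerivWithin_le
      (fun c _ => (hN c).hasFDerivWithinAt) (fun c _ => hb c) (mem_univ b) (mem_univ a)
  have hcontr : ∀ y, ContractingWith ⟨q, hq0⟩ fun c => y + N c := fun y =>
    ⟨hq, LipschitzWith.of_dist_le_mul fun a b => by
      rw [dist_add_left, dist_eq_norm, dist_eq_norm]
      exact hlip a b⟩
  let S : P → P := fun y => (hcontr y).fixedPoint
  have hS : ∀ y, S y = y + N (S y) := fun y => ((hcontr y).fixedPoint_isFixedPt).symm
  have hS2 : ∀ c, S (c - N c) = c := fun c =>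
    ((hcontr (c - N c)).fixedPoint_unique (sub_add_cancel c (N c))).symm
  have hSlip : ∀ a b, ‖S a - S b‖ ≤ (1 - q)⁻¹ * ‖a - b‖ := fun a b => by
    have h1 : S a - S b = (a - b) + (N (S a) - N (S b)) := by
      conv_lhs => rw [hS a, hS b]
      abel
    have h2 : ‖S a - S b‖ ≤ ‖a - b‖ + q * ‖S a - S b‖ := by
      conv_lhs => rw [h1]
      exact (norm_add_le _ _).trans (by gcongr; exact hlip _ _)
    rw [inv_mul_eq_div, le_div_iff₀ (by linarith)]
    linarith
  have hSc : Continuous S := (LipschitzWith.of_dist_le_mul (K := ⟨(1 - q)⁻¹, by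
    rw [inv_nonneg]; linarith⟩) fun a b => by
      rw [dist_eq_norm, dist_eq_norm]; exact hSlip a b).continuous
  have hlt : ∀ y, ‖N' (S y)‖ < 1 := fun y => (hb _).trans_lt hq
  -- `Ring.inverse` is continuous at units, and `1 - N' (S y)` is a unit by the Neumann series.
  refine ⟨S, fun y => Ring.inverse (1 - N' (S y)), hS, hS2, ?_, fun y => ?_, fun y => ?_⟩
  · refine continuous_iff_continuousAt.2 fun y => ?_
    have h1 : ContinuousAt Ring.inverse (1 - N' (S y)) :=
      NormedRing.inverse_continuousAt (Units.oneSub _ (hlt y))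
    exact ContinuousAt.comp (g := Ring.inverse) h1
      (continuous_const.sub (hN'.comp hSc)).continuousAt
  · have h1 : HasFDerivAt (fun c => c - N c)
        ((ContinuousLinearEquiv.ofUnit (Units.oneSub _ (hlt y)) : P ≃L[ℝ] P) : P →L[ℝ] P) (S y) :=
      (hasFDerivAt_id (S y)).sub (hN (S y))
    have h2 := HasFDerivAt.of_local_left_inverse hSc.continuousAt h1
      (Eventually.of_forall fun z => by
        conv_lhs => rw [hS z]
        exact (congrArg _ (by rw [← hS z])).trans (add_sub_cancel_right z (N (S z))))
    change HasFDerivAt S (Ring.inverse (1 - N' (S y))) y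
    rw [NormedRing.inverse_one_sub _ (hlt y)]
    exact h2
  · have h1 : (1 - N' (S y)) * Ring.inverse (1 - N' (S y)) = 1 :=
      Ring.mul_inverse_cancel _ (Units.oneSub _ (hlt y)).isUnit
    rw [sub_mul, one_mul, sub_eq_iff_eq_add] at h1
    exact h1

end ShapeGroup

/-! ### The space `C^1_b` and the Micheletti group as an open set of perturbations. -/

namespace ShapeGroup

open Set Filter Topology

variable {d : ℕ}

/-- The element of `C^1_b` given by a function, its derivative, and bounds for both. -/
noncomputable def C1b.ofBounds (f : E d → E d) (f' : E d → E d →L[ℝ] E d)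
    (h : ∀ x, HasFDerivAt f (f' x) x) (hc : Continuous f') (C C' : ℝ) (hC : ∀ x, ‖f x‖ ≤ C)
    (hC' : ∀ x, ‖f' x‖ ≤ C') : C1b d :=
  ⟨(BoundedContinuousFunction.ofNormedAddCommGroup f
      (continuous_iff_continuousAt.2 fun x => (h x).continuousAt) C hC,
    BoundedContinuousFunction.ofNormedAddCommGroup f' hc C' hC'), h⟩

theorem C1b.norm_le_iff (f : C1b d) {r : ℝ} (hr : 0 ≤ r) :
    ‖f‖ ≤ r ↔ (∀ x, ‖f x‖ ≤ r) ∧ ∀ x, ‖f.1.2 x‖ ≤ r := by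
  have h : ‖f‖ = max ‖f.1.1‖ ‖f.1.2‖ := rfl
  rw [h, max_le_iff, BoundedContinuousFunction.norm_le hr, BoundedContinuousFunction.norm_le hr]

theorem C1b.norm_apply_le (f : C1b d) (x : E d) : ‖f x‖ ≤ ‖f‖ :=
  ((C1b.norm_le_iff f (norm_nonneg f)).1 le_rfl).1 x

theorem C1b.norm_fderiv_le (f : C1b d) (x : E d) : ‖f.1.2 x‖ ≤ ‖f‖ :=
  ((C1b.norm_le_iff f (norm_nonneg f)).1 le_rfl).2 x

theorem C1b.add_apply (f g : C1b d) (x : E d) : (f + g) x = f x + g x := rfl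

theorem C1b.sub_apply (f g : C1b d) (x : E d) : (f - g) x = f x - g x := rfl

theorem C1b.neg_apply (f : C1b d) (x : E d) : (-f) x = -f x := rfl

theorem C1b.smul_apply (c : ℝ) (f : C1b d) (x : E d) : (c • f) x = c • f x := rfl

theorem C1b.norm_sub_le (f : C1b d) (x y : E d) : ‖f x - f y‖ ≤ ‖f‖ * ‖x - y‖ :=
  convex_univ.norm_image_sub_le_of_norm_hasFDerivWithin_le
    (fun z _ => (f.2 z).hasFDerivWithinAt) (fun z _ => C1b.norm_fderiv_le f z) (mem_univ y) (mem_univ x)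

theorem C1b.continuous (f : C1b d) : Continuous f := f.1.1.continuous

theorem dev_eq {F : Micheletti d} {g : C1b d} (h : ∀ x, F x = x + g x) : dev F = g :=
  C1b.ext fun x => add_left_cancel ((apply_eq_add_dev F x).symm.trans (h x))

theorem chart_apply (F F' : Micheletti d) (x : E d) : chart F F' x = F' x - F x := by
  rw [chart, C1b.sub_apply, apply_eq_add_dev F', apply_eq_add_dev F]
  abel

theorem chart_eq {F F' : Micheletti d} {h : C1b d} (H : ∀ x, F' x = F x + h x) :
    chart F F' = h := C1b.ext fun x => by rw [chart_apply, H, add_sub_cancel_left]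

theorem chart_self (F : Micheletti d) : chart F F = 0 := sub_self _

theorem param_eq {F F' : Micheletti d} {h : C1b d} (H : ∀ x, F' x = F x + h x) :
    param F h = F' := by
  rw [← chart_eq H, param_chart]

theorem Micheletti.ext {F G : Micheletti d} (h : ∀ x, F x = G x) : F = G :=
  Subtype.ext (Equiv.ext h)

theorem mul_apply (F G : Micheletti d) (x : E d) : (F * G) x = F (G x) := rfl

theorem inv_apply_self (F : Micheletti d) (x : E d) : F⁻¹ (F x) = x := F.1.symm_apply_apply x

theorem apply_inv_self (F : Micheletti d) (x : E d) : F (F⁻¹ x) = x := F.1.apply_symm_apply x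

theorem hasFDerivAt_micheletti (F : Micheletti d) (x : E d) :
    HasFDerivAt F (ContinuousLinearMap.id ℝ (E d) + (dev F).1.2 x) x := by
  have h : (F : E d → E d) = fun x => x + dev F x := funext (apply_eq_add_dev F)
  rw [h]
  exact (hasFDerivAt_id x).add ((dev F).2 x)

theorem continuous_micheletti (F : Micheletti d) : Continuous F :=
  continuous_iff_continuousAt.2 fun x => (hasFDerivAt_micheletti F x).continuousAt

/-- The homeomorphism underlying an element of the Micheletti group. -/
def Micheletti.toHomeomorph (F : Micheletti d) : E d ≃ₜ E d where
  toEquiv := F.1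
  continuous_toFun := continuous_micheletti F
  continuous_invFun := continuous_micheletti F⁻¹

theorem frontier_image (F : Micheletti d) (Ω : Set (E d)) :
    frontier (F '' Ω) = F '' frontier Ω := (F.toHomeomorph.image_frontier Ω).symm

theorem isOpen_image (F : Micheletti d) {Ω : Set (E d)} (h : IsOpen Ω) : IsOpen (F '' Ω) :=
  F.toHomeomorph.isOpen_image.2 h

/-- Composition of fields with an element of the Micheletti group, as a linear map. -/
noncomputable def precompₗ (F : Micheletti d) : C1b d →ₗ[ℝ] C1b d where
  toFun X := C1b.ofBounds (fun x => X (F x))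
    (fun x => (X.1.2 (F x)).comp (ContinuousLinearMap.id ℝ (E d) + (dev F).1.2 x))
    (fun x => HasFDerivAt.comp (g := X.1.1) x (X.2 (F x)) (hasFDerivAt_micheletti F x))
    ((X.1.2.continuous.comp (continuous_micheletti F)).clm_comp
      (continuous_const.add (dev F).1.2.continuous))
    ‖X‖ (‖X‖ * (1 + ‖dev F‖)) (fun x => C1b.norm_apply_le X _) (fun x => by
      refine (ContinuousLinearMap.opNorm_comp_le _ _).trans ?_
      refine mul_le_mul (C1b.norm_fderiv_le X _) ?_ (norm_nonneg _) (norm_nonneg X)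
      exact (norm_add_le _ _).trans
        (add_le_add ContinuousLinearMap.norm_id_le (C1b.norm_fderiv_le (dev F) _)))
  map_add' _ _ := C1b.ext fun _ => rfl
  map_smul' _ _ := C1b.ext fun _ => rfl

/-- Composition of fields with an element of the Micheletti group, as a continuous linear map. -/
noncomputable def precomp (F : Micheletti d) : C1b d →L[ℝ] C1b d :=
  (precompₗ F).mkContinuous (1 + ‖dev F‖) fun X => by
    have h0 : 0 ≤ ‖dev F‖ := norm_nonneg _
    have h1 : 0 ≤ ‖X‖ := norm_nonneg _
    refine (C1b.norm_le_iff _ (by positivity)).2 ⟨fun x => ?_, fun x => ?_⟩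
    · exact (C1b.norm_apply_le X _).trans (by nlinarith)
    · refine (ContinuousLinearMap.opNorm_comp_le _ _).trans ?_
      rw [mul_comm]
      refine mul_le_mul ?_ (C1b.norm_fderiv_le X _) (norm_nonneg _) (by positivity)
      exact (norm_add_le _ _).trans
        (add_le_add ContinuousLinearMap.norm_id_le (C1b.norm_fderiv_le (dev F) _))

theorem precomp_apply (F : Micheletti d) (X : C1b d) (x : E d) : precomp F X x = X (F x) := rfl

theorem precomp_precomp_inv (F : Micheletti d) (X : C1b d) : precomp F (precomp F⁻¹ X) = X :=
  C1b.ext fun x => by rw [precomp_apply, precomp_apply, inv_apply_self]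

theorem precomp_inv_precomp (F : Micheletti d) (X : C1b d) : precomp F⁻¹ (precomp F X) = X :=
  C1b.ext fun x => by rw [precomp_apply, precomp_apply, apply_inv_self]

/-- Small `C^1_b` perturbations of the identity belong to the Micheletti group. -/
theorem exists_id_add (g : C1b d) (hg : ‖g‖ < 1) : ∃ G : Micheletti d, ∀ x, G x = x + g x := by
  obtain ⟨S, S', h1, h2, h3, h4, h5⟩ := exists_inverse_id_sub (fun x => -g x) (fun x => -g.1.2 x)
    hg (fun x => (g.2 x).neg) g.1.2.continuous.neg
    (fun x => (norm_neg _).trans_le (C1b.norm_fderiv_le g x))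
  -- The bound comes from `S' = id + N' S'`. It is what puts the inverse in `id + C^1_b`.
  have hS' : ∀ y, ‖S' y‖ ≤ (1 - ‖g‖)⁻¹ := fun y => by
    have h : ‖S' y‖ ≤ 1 + ‖g‖ * ‖S' y‖ := by
      conv_lhs => rw [h5 y]
      refine (norm_add_le _ _).trans (add_le_add ContinuousLinearMap.norm_id_le ?_)
      refine (ContinuousLinearMap.opNorm_comp_le _ _).trans ?_
      gcongr
      exact (norm_neg _).trans_le (C1b.norm_fderiv_le g _)
    rw [← one_div, le_div_iff₀ (by linarith)]
    linarith
  let k : C1b d := C1b.ofBounds (fun y => S y - y) (fun y => S' y - ContinuousLinearMap.id ℝ (E d))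
    (fun y => (h4 y).sub (hasFDerivAt_id y)) (h3.sub continuous_const) ‖g‖ ((1 - ‖g‖)⁻¹ + 1)
    (fun y => by
      have h : S y - y = -g (S y) := by 
        conv_lhs => rw [h1 y]
        exact add_sub_cancel_left y _
      rw [h, norm_neg]
      exact C1b.norm_apply_le g _)
    (fun y => (norm_sub_le _ _).trans (add_le_add (hS' y) ContinuousLinearMap.norm_id_le))
  refine ⟨⟨⟨fun x => x + g x, S, fun x => ?_, fun y => ?_⟩, ⟨g, fun x => rfl⟩, ⟨k, fun y => ?_⟩⟩,
    fun x => rfl⟩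
  · simpa using h2 x
  · change S y + g (S y) = y
    nth_rewrite 1 [h1 y]
    exact neg_add_cancel_right y _
  · exact (add_sub_cancel y (S y)).symm

/-- `F + h` belongs to the Micheletti group for small `h`. -/
theorem eventually_exists_add (F : Micheletti d) :
    ∀ᶠ h in 𝓝 (0 : C1b d), ∃ F' : Micheletti d, ∀ x, F' x = F x + h x := by
  -- `F + h = (id + h ∘ F⁻¹) ∘ F`, and `h ∘ F⁻¹` is small with `h`.
  have hc : Tendsto (fun h => ‖precomp F⁻¹ h‖) (𝓝 0) (𝓝 0) := by
    have := ((precomp F⁻¹).continuous.norm).tendsto (0 : C1b d)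
    simpa using this
  filter_upwards [hc.eventually_lt_const one_pos] with h hh
  obtain ⟨G, hG⟩ := exists_id_add _ hh
  refine ⟨G * F, fun x => ?_⟩
  rw [mul_apply, hG, precomp_apply, inv_apply_self]

/-- Charts are open at their centre, so smoothness on a chart image gives genuine differentiability
at `0`. -/
theorem chart_image_mem_nhds {F : Micheletti d} {U : Set (Micheletti d)} (hU : IsOpen U)
    (hF : F ∈ U) : chart F '' U ∈ 𝓝 (0 : C1b d) := by
  obtain ⟨V, hV, rfl⟩ := isOpen_induced_iff.1 hU
  have hc : Tendsto (fun h => dev F + h) (𝓝 0) (𝓝 (dev F)) := by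
    have := (continuous_const_add (dev F)).tendsto 0
    rwa [add_zero] at this
  filter_upwards [eventually_exists_add F, hc.eventually (hV.mem_nhds hF)] with h ⟨F', h1⟩ h2
  refine ⟨F', ?_, chart_eq h1⟩
  have h3 : dev F' = dev F + h := dev_eq fun x => by
    rw [h1, C1b.add_apply, ← add_assoc, ← apply_eq_add_dev]
  rwa [mem_preimage, h3]

end ShapeGroup

/-! ### Differentials of functions on the quotient, and reduction of curves to lines. -/

namespace ShapeGroup

open Set Filter Topology

variable {d : ℕ} {Ω : Set (E d)} {p : ShapeQuotient Ω}

/-- A function on the quotient, read in the chart `φ_F`. -/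
noncomputable def localRep (F : Micheletti d) (f : SmoothFunAt Ω p) (h : C1b d) : ℝ :=
  f.toFun (proj Ω (param F h))

/-- The differential at `F` of a function on the quotient. -/
noncomputable def differential (F : Micheletti d) (f : SmoothFunAt Ω p) : C1b d →L[ℝ] ℝ :=
  fderiv ℝ (localRep F f) 0

theorem localRep_chart (F F' : Micheletti d) (f : SmoothFunAt Ω p) :
    localRep F f (chart F F') = f.toFun (proj Ω F') := by
  rw [localRep, param_chart]

theorem proj_eq_iff {F F' : Micheletti d} : proj Ω F = proj Ω F' ↔ F '' Ω = F' '' Ω := by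
  rw [proj, proj, QuotientGroup.eq]
  change (F⁻¹ * F' : Micheletti d) '' Ω = Ω ↔ _
  have h : ((F⁻¹ * F' : Micheletti d) : E d → E d) '' Ω = F.1.symm '' (F' '' Ω) :=
    image_comp F.1.symm F' Ω
  rw [h]
  constructor
  · intro h'
    conv_lhs => rw [← h']
    exact F.1.image_symm_image _
  · intro h'
    rw [← h']
    exact F.1.symm_image_image Ω

theorem hasFDerivAt_localRep {F : Micheletti d} (hF : proj Ω F = p) (f : SmoothFunAt Ω p) :
    HasFDerivAt (localRep F f) (differential F f) 0 := by
  have hU : IsOpen (proj Ω ⁻¹' f.dom) := f.isOpen_dom.preimage QuotientGroup.continuous_mk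
  have hm : F ∈ proj Ω ⁻¹' f.dom := by rw [mem_preimage, hF]; exact f.mem_dom
  have h := (f.smooth F).contDiffAt (chart_image_mem_nhds hU hm)
  exact (h.differentiableAt (by simp)).hasFDerivAt

theorem CurveAt.hasDerivAt (γ : CurveAt Ω p) :
    HasDerivAt (fun t => chart (γ.toFun 0) (γ.toFun t)) γ.velocity 0 :=
  ((γ.contDiff.contDiffAt (Ioo_mem_nhds (neg_lt_zero.2 γ.δ_pos) γ.ε_pos)).differentiableAt
    (by simp)).hasDerivAt

theorem CurveAt.derivAlong_eq (γ : CurveAt Ω p) (f : SmoothFunAt Ω p) :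
    γ.derivAlong f = differential (γ.toFun 0) f γ.velocity := by
  have h1 := hasFDerivAt_localRep γ.proj_zero f
  rw [← chart_self (γ.toFun 0)] at h1
  have h2 := (HasFDerivAt.comp_hasDerivAt (0 : ℝ) h1 γ.hasDerivAt).deriv
  rw [← h2]
  refine congrArg (fun u => deriv u 0) (funext fun t => ?_)
  exact (localRep_chart _ _ f).symm

theorem param_zero (F : Micheletti d) : param F 0 = F := param_eq fun x => (add_zero (F x)).symm

/-- `f` takes the same value at `F' * g` and `F'`, and near `0` the point `F * g + h` is `(F + h ∘
g⁻¹) * g`. The two local representatives therefore differ by the linear map `precomp g⁻¹`. -/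
theorem differential_mul {F g : Micheletti d} (hF : proj Ω F = p) (hg : g ∈ stab Ω)
    (f : SmoothFunAt Ω p) (V : C1b d) :
    differential (F * g) f V = differential F f (precomp g⁻¹ V) := by
  have hFg : ∀ F' : Micheletti d, proj Ω (F' * g) = proj Ω F' := fun F' =>
    QuotientGroup.mk_mul_of_mem F' hg
  have h1 := hasFDerivAt_localRep ((hFg F).trans hF) f
  have h2 := hasFDerivAt_localRep hF f
  have h3 : HasFDerivAt (localRep F f ∘ precomp g⁻¹)
      ((differential F f).comp (precomp g⁻¹)) 0 :=
    HasFDerivAt.comp (g := localRep F f) 0 (by rw [map_zero]; exact h2)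
      (precomp g⁻¹).hasFDerivAt
  have h4 : localRep F f ∘ precomp g⁻¹ =ᶠ[𝓝 0] localRep (F * g) f := by
    filter_upwards [eventually_exists_add (F * g)] with h ⟨F', hF'⟩
    have e1 : param (F * g) h = F' := param_eq hF'
    have e2 : param F (precomp g⁻¹ h) = F' * g⁻¹ := param_eq fun x => by
      rw [mul_apply, hF', precomp_apply, mul_apply, apply_inv_self]
    rw [Function.comp_apply, localRep, localRep, e1, e2, ← hFg (F' * g⁻¹), inv_mul_cancel_right]
  exact DFunLike.congr_fun (h1.unique (h3.congr_of_eventuallyEq h4.symm)) V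

theorem exists_pos_forall_add_smul (F : Micheletti d) (X : C1b d) :
    ∃ ε > 0, ∀ t : ℝ, |t| < ε → ∃ F' : Micheletti d, ∀ x, F' x = F x + t • X x := by
  have hc : Tendsto (fun t : ℝ => t • X) (𝓝 0) (𝓝 0) := by
    have h : Continuous fun t : ℝ => t • X := continuous_id.smul continuous_const
    simpa using h.tendsto 0
  obtain ⟨ε, hε, h⟩ := Metric.eventually_nhds_iff.1 (hc.eventually (eventually_exists_add F))
  exact ⟨ε, hε, fun t ht => h (by simpa using ht)⟩

/-- The curve `t ↦ F + t X`. -/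
noncomputable def lineCurve (Ω : Set (E d)) (F : Micheletti d) (X : C1b d) :
    CurveAt Ω (proj Ω F) where
  toFun t := param F (t • X)
  δ := (exists_pos_forall_add_smul F X).choose
  ε := (exists_pos_forall_add_smul F X).choose
  δ_pos := (exists_pos_forall_add_smul F X).choose_spec.1
  ε_pos := (exists_pos_forall_add_smul F X).choose_spec.1
  contDiff := by
    have h : ContDiff ℝ 1 fun t : ℝ => t • X := contDiff_id.smul contDiff_const
    refine h.contDiffOn.congr fun t ht => ?_
    obtain ⟨F', hF'⟩ := (exists_pos_forall_add_smul F X).choose_spec.2 t (abs_lt.2 ht)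
    have e : param F (t • X) = F' := param_eq hF'
    rw [zero_smul, param_zero, e]
    exact chart_eq hF'
  proj_zero := by rw [zero_smul, param_zero]

theorem lineCurve_zero (F : Micheletti d) (X : C1b d) : (lineCurve Ω F X).toFun 0 = F := by
  change param F ((0 : ℝ) • X) = F
  rw [zero_smul, param_zero]

theorem velocity_lineCurve (F : Micheletti d) (X : C1b d) : (lineCurve Ω F X).velocity = X := by
  obtain ⟨ε, hε, h⟩ := exists_pos_forall_add_smul F X
  have h1 : HasDerivAt (fun t : ℝ => t • X) X 0 := by
    simpa using (hasDerivAt_id (0 : ℝ)).smul_const X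
  refine (h1.congr_of_eventuallyEq ?_).deriv
  filter_upwards [Metric.ball_mem_nhds (0 : ℝ) hε] with t ht
  obtain ⟨F', hF'⟩ := h t (by simpa using ht)
  have e : (lineCurve Ω F X).toFun t = F' := param_eq hF'
  rw [lineCurve_zero, e]
  exact chart_eq hF'

theorem derivAlong_lineCurve (F : Micheletti d) (X : C1b d) (f : SmoothFunAt Ω (proj Ω F)) :
    (lineCurve Ω F X).derivAlong f = differential F f X := by
  rw [CurveAt.derivAlong_eq, lineCurve_zero, velocity_lineCurve]

/-- Each curve is equivalent to a line through the given representative. -/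
theorem exists_derivAlong_eq (F : Micheletti d) (γ : CurveAt Ω (proj Ω F)) :
    ∃ X : C1b d, ∀ f, γ.derivAlong f = differential F f X := by
  have hg : F⁻¹ * γ.toFun 0 ∈ stab Ω := QuotientGroup.eq.1 γ.proj_zero.symm
  refine ⟨precomp (F⁻¹ * γ.toFun 0)⁻¹ γ.velocity, fun f => ?_⟩
  rw [← differential_mul rfl hg, mul_inv_cancel_left, CurveAt.derivAlong_eq]

/-- Differentials annihilate the velocities of families of transformations that preserve the
shape. -/
theorem differential_eq_zero_of_invariant (F : Micheletti d) (f : SmoothFunAt Ω (proj Ω F))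
    (G : ℝ → Micheletti d) (Y : C1b d) (h0 : G 0 = 1) (hG : HasDerivAt (fun t => dev (G t)) Y 0)
    (hinv : ∀ᶠ t in 𝓝 0, G t '' (F '' Ω) = F '' Ω) : differential F f (precomp F Y) = 0 := by
  have hdev : dev (1 : Micheletti d) = 0 := dev_eq fun x => (add_zero x).symm
  have h1 : HasFDerivAt (localRep F f) (differential F f) (precomp F (dev (G 0))) := by
    rw [h0, hdev, map_zero]; exact hasFDerivAt_localRep rfl f
  have h2 := HasFDerivAt.comp_hasDerivAt (0 : ℝ) h1
    ((precomp F).hasFDerivAt.comp_hasDerivAt (0 : ℝ) hG)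
  refine (h2.congr_of_eventuallyEq ?_).unique (hasDerivAt_const 0 (f.toFun (proj Ω F)))
  -- The curve `G t * F` has chart coordinate `dev (G t) ∘ F` and stays in the coset of `F`, so `f`
  -- is constant along it.
  filter_upwards [hinv] with t ht
  have e1 : precomp F (dev (G t)) = chart F (G t * F) := C1b.ext fun x => by
    rw [chart_apply, mul_apply, apply_eq_add_dev (G t), precomp_apply, add_sub_cancel_left]
  have e2 : proj Ω (G t * F) = proj Ω F := proj_eq_iff.2 ((image_comp (G t) F Ω).trans ht)
  change _ = localRep F f (precomp F (dev (G t)))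
  rw [e1, localRep_chart, e2]

end ShapeGroup

/-! ### Flows of fields and their derivative in the `C^1` norm. -/

namespace ShapeGroup

open Set Filter Topology

variable {d : ℕ}

/-- The primitive, vanishing at `0`, of a continuous path on the unit interval, as a linear map. -/
noncomputable def primitiveₗ (V : Type*) [NormedAddCommGroup V] [NormedSpace ℝ V] :
    C(unitInterval, V) →ₗ[ℝ] C(unitInterval, V) :=
  have hi : ∀ (u : C(unitInterval, V)) (a b : ℝ), IntervalIntegrable
      (fun r => u (projIcc 0 1 zero_le_one r)) MeasureTheory.volume a b := fun u a b =>
    (u.continuous.comp continuous_projIcc).intervalIntegrable a b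
  { toFun := fun u =>
      (⟨fun s => ∫ r in (0 : ℝ)..s, u (projIcc 0 1 zero_le_one r),
        (intervalIntegral.continuous_primitive (hi u) 0).comp continuous_subtype_val⟩ :
        C(unitInterval, V))
    map_add' := fun u v => ContinuousMap.ext fun _ =>
      intervalIntegral.integral_add (hi u _ _) (hi v _ _)
    map_smul' := fun a _ => ContinuousMap.ext fun _ => intervalIntegral.integral_smul a _ }

theorem norm_primitiveₗ_le {V : Type*} [NormedAddCommGroup V] [NormedSpace ℝ V]
    (u : C(unitInterval, V)) : ‖primitiveₗ V u‖ ≤ ‖u‖ := by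
  refine (ContinuousMap.norm_le _ (norm_nonneg u)).2 fun s => ?_
  refine (intervalIntegral.norm_integral_le_of_norm_le_const (C := ‖u‖) fun r _ =>
    u.norm_coe_le_norm _).trans ?_
  rw [sub_zero, abs_of_nonneg s.2.1]
  exact mul_le_of_le_one_right (norm_nonneg u) s.2.2

/-- The primitive, vanishing at `0`, of a continuous path on the unit interval. -/
noncomputable def primitive (V : Type*) [NormedAddCommGroup V] [NormedSpace ℝ V] :
    C(unitInterval, V) →L[ℝ] C(unitInterval, V) :=
  (primitiveₗ V).mkContinuous 1 fun u => (norm_primitiveₗ_le u).trans_eq (one_mul _).symm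

section Primitive

variable {V : Type*} [NormedAddCommGroup V] [NormedSpace ℝ V]

theorem primitive_apply (u : C(unitInterval, V)) (s : unitInterval) :
    primitive V u s = ∫ r in (0 : ℝ)..s, u (projIcc 0 1 zero_le_one r) := rfl

theorem norm_primitive_le (u : C(unitInterval, V)) : ‖primitive V u‖ ≤ ‖u‖ :=
  norm_primitiveₗ_le u

theorem primitive_const_one [CompleteSpace V] (v : V) :
    primitive V (ContinuousMap.const _ v) 1 = v := by
  simp [primitive_apply]

/-- Constant paths, as a continuous linear map. -/
noncomputable def constPath (V : Type*) [NormedAddCommGroup V] [NormedSpace ℝ V] :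
    V →L[ℝ] C(unitInterval, V) :=
  LinearMap.mkContinuous
    { toFun := fun v => ContinuousMap.const unitInterval v
      map_add' := fun _ _ => rfl
      map_smul' := fun _ _ => rfl } 1 fun v => by
    rw [one_mul]
    exact (ContinuousMap.norm_le _ (norm_nonneg v)).2 fun _ => le_rfl

theorem norm_constPath_le (v : V) : ‖constPath V v‖ ≤ ‖v‖ :=
  (ContinuousMap.norm_le _ (norm_nonneg v)).2 fun _ => le_rfl

end Primitive

/-- The time-`t` flow of a field in `C^1_b`, for small `t`. -/
theorem exists_flow_of_small (Y : C1b d) (t : ℝ) (ht : |t| * ‖Y‖ ≤ 1 / 4) :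
    ∃ W : C1b d, ‖W‖ ≤ 1 / 2 ∧
      (∀ x, ∃ c : ℝ → E d, c 0 = x ∧ c 1 = x + W x ∧
        ∀ s ∈ Icc (0 : ℝ) 1, HasDerivAt c (t • Y (c s)) s) ∧
      ∀ η, (∀ a b, ‖a - b‖ ≤ |t| * ‖Y‖ → ‖Y.1.2 a - Y.1.2 b‖ ≤ η) →
        ‖W - t • Y‖ ≤ |t| * (2 * η + 2 * (|t| * ‖Y‖) * ‖Y‖) := by
  have hY0 : 0 ≤ ‖Y‖ := norm_nonneg Y
  let φ : C(E d, E d) := ⟨Y, C1b.continuous Y⟩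
  let φ' : C(E d, E d →L[ℝ] E d) := ⟨Y.1.2, Y.1.2.continuous⟩
  let J := primitive (E d)
  let M : C(unitInterval, E d) → C(unitInterval, E d) →L[ℝ] C(unitInterval, E d) :=
    fun c => pointwiseApply unitInterval (E d) (E d) (φ'.comp c)
  have hMc : Continuous M :=
    (pointwiseApply unitInterval (E d) (E d)).continuous.comp (ContinuousMap.continuous_postcomp φ')
  have hM : ∀ c u, ‖M c u‖ ≤ ‖Y‖ * ‖u‖ := fun c u =>
    (ContinuousMap.norm_le _ (by positivity)).2 fun s =>
      (Y.1.2 (c s)).le_of_opNorm_le_of_le (C1b.norm_fderiv_le Y _) (u.norm_coe_le_norm s)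
  -- Time is rescaled to `[0, 1]`: the integral curve of `t Y` from `x` solves `c = K x + t J (Y ∘
  -- c)` in the space of paths. Thus `S (K x)` is that curve, and `S'` gives its dependence on `x`.
  obtain ⟨S, S', hS, -, hS'c, hS', hS'eq⟩ := exists_inverse_id_sub
    (fun c => t • J (φ.comp c)) (fun c => t • J.comp (M c)) (q := 1 / 4) (by norm_num)
    (fun c => (J.hasFDerivAt.comp c (hasFDerivAt_superposition φ φ' Y.2 c)).const_smul t)
    (((ContinuousLinearMap.compL ℝ _ _ _ J).continuous.comp hMc).const_smul t)
    (fun c => by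
      refine ContinuousLinearMap.opNorm_le_bound _ (by norm_num) fun u => ?_
      change ‖t • J (M c u)‖ ≤ _
      rw [norm_smul, Real.norm_eq_abs]
      calc |t| * ‖J (M c u)‖ ≤ |t| * (‖Y‖ * ‖u‖) := by
            gcongr; exact (norm_primitive_le _).trans (hM c u)
        _ = (|t| * ‖Y‖) * ‖u‖ := by ring
        _ ≤ 1 / 4 * ‖u‖ := by gcongr)
  have hS'app : ∀ y u, S' y u = u + t • J (M (S y) (S' y u)) := fun y u =>
    DFunLike.congr_fun (hS'eq y) u
  -- The perturbation has norm at most `1/4`, so the factor `4/3` would do.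
  have hS'2 : ∀ y u, ‖S' y u‖ ≤ 2 * ‖u‖ := fun y u => by
    have h : ‖S' y u‖ ≤ ‖u‖ + (|t| * ‖Y‖) * ‖S' y u‖ := by
      conv_lhs => rw [hS'app]
      refine (norm_add_le _ _).trans ?_
      rw [norm_smul, Real.norm_eq_abs, mul_assoc]
      gcongr
      exact (norm_primitive_le _).trans (hM _ _)
    nlinarith [norm_nonneg (S' y u), norm_nonneg u]
  let ev : C(unitInterval, E d) →L[ℝ] E d := ContinuousMap.evalCLM ℝ 1
  have hev : ∀ u, ev u = u 1 := fun _ => rfl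
  let K := constPath (E d)
  have hSK : ∀ x, S (K x) = K x + t • J (φ.comp (S (K x))) := fun x => hS (K x)
  have hφ : ∀ c : C(unitInterval, E d), ‖φ.comp c‖ ≤ ‖Y‖ := fun c =>
    (ContinuousMap.norm_le _ hY0).2 fun s => C1b.norm_apply_le Y _
  have hWx : ∀ x, ev (S (K x)) - x = t • J (φ.comp (S (K x))) 1 := fun x => by
    rw [hev]
    conv_lhs => rw [hSK]
    exact add_sub_cancel_left x _
  have hWv : ∀ x v, (ev.comp ((S' (K x)).comp K) - ContinuousLinearMap.id ℝ (E d)) v =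
      t • J (M (S (K x)) (S' (K x) (K v))) 1 := fun x v => by
    change S' (K x) (K v) 1 - v = _
    conv_lhs => rw [hS'app]
    exact add_sub_cancel_left v _
  have hKv : ∀ v, ‖K v‖ ≤ ‖v‖ := norm_constPath_le
  have hb1 : ∀ x, ‖ev (S (K x)) - x‖ ≤ 1 / 2 := fun x => by
    rw [hWx, norm_smul, Real.norm_eq_abs]
    have := ((J (φ.comp (S (K x)))).norm_coe_le_norm 1).trans
      ((norm_primitive_le _).trans (hφ (S (K x))))
    nlinarith [abs_nonneg t]
  have hb2 : ∀ x, ‖ev.comp ((S' (K x)).comp K) - ContinuousLinearMap.id ℝ (E d)‖ ≤ 1 / 2 :=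
    fun x => ContinuousLinearMap.opNorm_le_bound _ (by norm_num) fun v => by
      rw [hWv, norm_smul, Real.norm_eq_abs]
      have h1 := ((J (M (S (K x)) (S' (K x) (K v)))).norm_coe_le_norm 1).trans
        ((norm_primitive_le _).trans (hM (S (K x)) (S' (K x) (K v))))
      have h2 := (hS'2 (K x) (K v)).trans (mul_le_mul_of_nonneg_left (hKv v) zero_le_two)
      calc |t| * _ ≤ |t| * (‖Y‖ * (2 * ‖v‖)) := by gcongr; exact h1.trans (by gcongr)
        _ = 2 * (|t| * ‖Y‖) * ‖v‖ := by ring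
        _ ≤ 1 / 2 * ‖v‖ := by gcongr; linarith
  let W : C1b d := C1b.ofBounds (fun x => ev (S (K x)) - x)
    (fun x => ev.comp ((S' (K x)).comp K) - ContinuousLinearMap.id ℝ (E d))
    (fun x => ((ev.hasFDerivAt.comp x ((hS' (K x)).comp x K.hasFDerivAt))).sub (hasFDerivAt_id x))
    ((continuous_const.clm_comp ((hS'c.comp K.continuous).clm_comp continuous_const)).sub
      continuous_const) (1 / 2) (1 / 2) hb1 hb2
  refine ⟨W, (C1b.norm_le_iff W (by norm_num)).2 ⟨hb1, hb2⟩, fun x => ?_, fun η hη => ?_⟩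
  · let g : ℝ → E d := fun r => φ (S (K x) (projIcc 0 1 zero_le_one r))
    have hg : Continuous g := φ.continuous.comp ((S (K x)).continuous.comp continuous_projIcc)
    -- The integrand is extended constantly beyond `[0, 1]`, so `c` has two-sided derivatives at the
    -- endpoints too.
    let c : ℝ → E d := fun s => x + t • ∫ r in (0 : ℝ)..s, g r
    have hc : ∀ s : unitInterval, c s = S (K x) s := fun s => by
      conv_rhs => rw [hSK]
      rfl
    refine ⟨c, by simp [c], ?_, fun s hs => ?_⟩
    · have := hc 1
      rw [Icc.coe_one] at this
      rw [this]
      exact (add_sub_cancel x (ev (S (K x)))).symm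
    · have h1 : HasDerivAt c (t • g s) s :=
        ((hg.integral_hasStrictDerivAt 0 s).hasDerivAt.const_smul t).const_add x
      have h2 : g s = Y (c s) := by
        have := hc ⟨s, hs⟩
        change c s = _ at this
        rw [this]
        change φ (S (K x) (projIcc 0 1 zero_le_one s)) = _
        rw [projIcc_of_mem zero_le_one hs]
        rfl
      rwa [h2] at h1
  -- Integral curves stay within `|t| * ‖Y‖` of their start; this is the scale at which `η` bounds
  -- the oscillation of `DY`.
  · have hclose : ∀ x (r : unitInterval), ‖S (K x) r - x‖ ≤ |t| * ‖Y‖ := fun x r => by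
      have h : S (K x) r - x = t • J (φ.comp (S (K x))) r := by
        conv_lhs => rw [hSK]
        exact add_sub_cancel_left x _
      rw [h, norm_smul, Real.norm_eq_abs]
      gcongr
      exact ((J (φ.comp (S (K x)))).norm_coe_le_norm r).trans
        ((norm_primitive_le _).trans (hφ _))
    have hη0 : 0 ≤ η := (norm_nonneg _).trans (hη 0 0 (by simpa using by positivity))
    -- `J u 1` is the mean of `u`, so it is as close to `v` as the values of `u` are.
    have hJ1 : ∀ (u : C(unitInterval, E d)) v C, 0 ≤ C → (∀ r, ‖u r - v‖ ≤ C) →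
        ‖t • J u 1 - t • v‖ ≤ |t| * C := fun u v C hC h => by
      have e : t • J u 1 - t • v = t • J (u - K v) 1 := by
        rw [map_sub, ContinuousMap.sub_apply, smul_sub]
        congr 2
        exact (primitive_const_one v).symm
      rw [e, norm_smul, Real.norm_eq_abs]
      gcongr
      exact ((J (u - K v)).norm_coe_le_norm 1).trans ((norm_primitive_le _).trans
        ((ContinuousMap.norm_le _ hC).2 h))
    refine (C1b.norm_le_iff _ (by positivity)).2 ⟨fun x => ?_, fun x => ?_⟩
    · change ‖ev (S (K x)) - x - t • Y x‖ ≤ _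
      rw [hWx]
      refine hJ1 _ _ _ (by positivity) fun r => ?_
      refine (C1b.norm_sub_le Y _ _).trans ?_
      have := mul_le_mul_of_nonneg_left (hclose x r) hY0
      nlinarith [mul_nonneg (mul_nonneg (abs_nonneg t) hY0) hY0]
    · refine ContinuousLinearMap.opNorm_le_bound _ (by positivity) fun v => ?_
      change ‖(ev.comp ((S' (K x)).comp K) - ContinuousLinearMap.id ℝ (E d)) v -
        t • Y.1.2 x v‖ ≤ _
      rw [hWv, mul_assoc]
      refine hJ1 _ _ _ (by positivity) fun r => ?_
      set w := S' (K x) (K v) with hw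
      have hw2 : ‖w‖ ≤ 2 * ‖v‖ :=
        (hS'2 (K x) (K v)).trans (mul_le_mul_of_nonneg_left (hKv v) zero_le_two)
      have hwv : ‖w r - v‖ ≤ |t| * (‖Y‖ * (2 * ‖v‖)) := by
        have h : w r - v = t • J (M (S (K x)) w) r := by
          conv_lhs => rw [hw, hS'app]
          exact add_sub_cancel_left v _
        rw [h, norm_smul, Real.norm_eq_abs]
        gcongr
        exact ((J (M (S (K x)) w)).norm_coe_le_norm r).trans ((norm_primitive_le _).trans
          ((hM _ _).trans (by gcongr)))
      have e : M (S (K x)) w r - Y.1.2 x v =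
          (Y.1.2 (S (K x) r) - Y.1.2 x) (w r) + Y.1.2 x (w r - v) := by
        change Y.1.2 (S (K x) r) (w r) - Y.1.2 x v = _
        rw [sub_apply, map_sub]
        abel
      rw [e]
      calc _ ≤ η * (2 * ‖v‖) + ‖Y‖ * (|t| * (‖Y‖ * (2 * ‖v‖))) :=
            (norm_add_le _ _).trans (add_le_add
              (ContinuousLinearMap.le_of_opNorm_le_of_le _ (hη _ _ (hclose x r))
                ((w.norm_coe_le_norm r).trans hw2))
              (ContinuousLinearMap.le_of_opNorm_le_of_le _ (C1b.norm_fderiv_le Y x) hwv))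
        _ = _ := by ring

/-- The flow of a field in `C^1_b` with uniformly continuous derivative is differentiable in the
`C^1` norm at time `0`. -/
theorem exists_flow (Y : C1b d) (hu : UniformContinuous Y.1.2) :
    ∃ G : ℝ → Micheletti d, G 0 = 1 ∧ HasDerivAt (fun t => dev (G t)) Y 0 ∧
      ∀ᶠ t in 𝓝 0, ∀ x, ∃ c : ℝ → E d, c 0 = x ∧ c 1 = G t x ∧
        ∀ s ∈ Icc (0 : ℝ) 1, HasDerivAt c (t • Y (c s)) s := by
  have hsmall : ∀ δ > 0, ∀ᶠ t : ℝ in 𝓝 0, |t| * ‖Y‖ < δ := fun δ hδ => by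
    have h : Continuous fun t : ℝ => |t| * ‖Y‖ := continuous_abs.mul continuous_const
    have h2 := h.tendsto 0
    simp only [abs_zero, zero_mul] at h2
    exact h2.eventually_lt_const hδ
  choose! W hW1 hW2 hW3 using exists_flow_of_small Y
  -- Large `t` receive the dummy value `1`; only `t` near `0` matters.
  have hG : ∀ t, ∃ G : Micheletti d, |t| * ‖Y‖ ≤ 1 / 4 → dev G = W t := fun t => by
    by_cases ht : |t| * ‖Y‖ ≤ 1 / 4
    · obtain ⟨G, hG⟩ := exists_id_add (W t) ((hW1 t ht).trans_lt (by norm_num))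
      exact ⟨G, fun _ => dev_eq hG⟩
    · exact ⟨1, fun h => absurd h ht⟩
  choose G hG using hG
  have h14 : ∀ᶠ t : ℝ in 𝓝 0, |t| * ‖Y‖ ≤ 1 / 4 :=
    (hsmall (1 / 4) (by norm_num)).mono fun _ h => h.le
  have hG0 : dev (G 0) = 0 := by
    have h0 : |(0 : ℝ)| * ‖Y‖ ≤ 1 / 4 := by norm_num
    rw [hG 0 h0]
    -- At `t = 0` even the crude oscillation bound `2 * ‖Y‖` forces `W 0 = 0`.
    have := hW3 0 h0 (2 * ‖Y‖) fun a b _ => (norm_sub_le _ _).trans (by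
      have := C1b.norm_fderiv_le Y a
      have := C1b.norm_fderiv_le Y b
      linarith)
    rw [zero_smul, sub_zero, abs_zero, zero_mul] at this
    exact norm_le_zero_iff.1 this
  refine ⟨G, Micheletti.ext fun x => ?_, ?_, ?_⟩
  · rw [apply_eq_add_dev, hG0]
    exact add_zero x
  · rw [hasDerivAt_iff_isLittleO_nhds_zero, Asymptotics.isLittleO_iff]
    intro ε hε
    -- Both terms of the estimate, `2η` and `2|t|‖Y‖²`, are made at most `ε / 2`.
    obtain ⟨δ, hδ, hδu⟩ := Metric.uniformContinuous_iff.1 hu (ε / 4) (by positivity)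
    filter_upwards [h14, hsmall δ hδ, hsmall (ε / (4 * (‖Y‖ + 1))) (by positivity)]
      with t h1 h2 h3
    rw [zero_add, hG0, sub_zero, hG t h1, Real.norm_eq_abs, mul_comm]
    refine (hW3 t h1 (ε / 4) fun a b hab => ?_).trans ?_
    · rw [← dist_eq_norm]
      exact (hδu (by rw [dist_eq_norm]; exact hab.trans_lt h2)).le
    · have h4 : |t| * ‖Y‖ * ‖Y‖ ≤ ε / 4 := by
        have : ε / (4 * (‖Y‖ + 1)) * (‖Y‖ + 1) = ε / 4 := by field_simp
        have hn := norm_nonneg Y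
        have : 0 ≤ ε / (4 * (‖Y‖ + 1)) := by positivity
        nlinarith
      gcongr
      linarith
  · filter_upwards [h14] with t ht x
    obtain ⟨c, h1, h2, h3⟩ := hW2 t ht x
    exact ⟨c, h1, by rw [h2, apply_eq_add_dev, hG t ht], h3⟩

end ShapeGroup

/-! ### Invariance of sets under paths, and subtangential directions. -/

namespace ShapeGroup

open Set Filter Topology

variable {d : ℕ}

/-- Otherwise the connected image of the path would be split by the interiors of `S` and of its
complement. -/
theorem exists_mem_frontier_of_path {S : Set (E d)} {c : ℝ → E d}
    (hc : ContinuousOn c (Icc 0 1)) {a b : ℝ} (ha : a ∈ Icc (0 : ℝ) 1) (hb : b ∈ Icc (0 : ℝ) 1)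
    (hcS : c a ∈ S) (hcS' : c b ∉ S) : ∃ s ∈ Icc (0 : ℝ) 1, c s ∈ frontier S := by
  by_contra! H
  have hpre : IsPreconnected (c '' Icc 0 1) := isPreconnected_Icc.image c hc
  have hin : ∀ s ∈ Icc (0 : ℝ) 1, c s ∈ S → c s ∈ interior S := fun s hs h => by
    by_contra h'
    exact H s hs ⟨subset_closure h, h'⟩
  have hout : ∀ s ∈ Icc (0 : ℝ) 1, c s ∉ S → c s ∈ interior Sᶜ := fun s hs h => by
    by_contra h'
    refine H s hs ?_
    rw [← frontier_compl]
    exact ⟨subset_closure h, h'⟩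
  obtain ⟨y, -, h1, h2⟩ := hpre _ _ isOpen_interior isOpen_interior
    (by
      rintro _ ⟨s, hs, rfl⟩
      by_cases h : c s ∈ S
      · exact Or.inl (hin s hs h)
      · exact Or.inr (hout s hs h))
    ⟨c a, mem_image_of_mem c ha, hin a ha hcS⟩ ⟨c b, mem_image_of_mem c hb, hout b hb hcS'⟩
  exact interior_subset h2 (interior_subset h1)

/-- A transformation that moves points along paths which either stay on the frontier of an open
set or avoid it preserves the set. -/
theorem image_eq_of_paths {S : Set (E d)} (hS : IsOpen S) (G : Micheletti d)
    (h : ∀ x, ∃ c : ℝ → E d, ContinuousOn c (Icc 0 1) ∧ c 0 = x ∧ c 1 = G x ∧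
      ∀ s ∈ Icc (0 : ℝ) 1, c s ∈ frontier S → c 0 ∈ frontier S ∧ c 1 ∈ frontier S) :
    G '' S = S := by
  have h0 : (0 : ℝ) ∈ Icc (0 : ℝ) 1 := by simp
  have h1 : (1 : ℝ) ∈ Icc (0 : ℝ) 1 := by simp
  have hfr : ∀ x, x ∈ S → x ∉ frontier S := fun x hx hx' =>
    (hS.inter_frontier_eq.subset ⟨hx, hx'⟩ : x ∈ (∅ : Set (E d)))
  have key : ∀ x, x ∈ S ↔ G x ∈ S := fun x => by
    obtain ⟨c, hc, rfl, e1, H⟩ := h x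
    rw [← e1]
    constructor
    · intro hx
      by_contra hx'
      obtain ⟨s, hs, hs'⟩ := exists_mem_frontier_of_path hc h0 h1 hx hx'
      exact hfr _ hx (H s hs hs').1
    · intro hx
      by_contra hx'
      obtain ⟨s, hs, hs'⟩ := exists_mem_frontier_of_path hc h1 h0 hx hx'
      exact hfr _ hx (H s hs hs').2
  ext y
  constructor
  · rintro ⟨x, hx, rfl⟩
    exact (key x).1 hx
  · intro hy
    refine ⟨G⁻¹ y, (key _).2 ?_, apply_inv_self G y⟩
    rwa [apply_inv_self]

/-- Nagumo's invariance theorem: a closed set is invariant under the trajectories of a Lipschitz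
field that is subtangential to it. -/
theorem mem_of_subtangential {K : Set (E d)} (hK : IsClosed K) (Y : C1b d)
    (hY : ∀ k ∈ K, ∀ η > 0, ∀ᶠ h : ℝ in 𝓝[>] 0, Metric.infDist (k + h • Y k) K ≤ η * h)
    {c : ℝ → E d} (hc : ∀ s ∈ Icc (0 : ℝ) 1, HasDerivAt c (Y (c s)) s) (h0 : c 0 ∈ K) :
    ∀ s ∈ Icc (0 : ℝ) 1, c s ∈ K := by
  have hne : K.Nonempty := ⟨_, h0⟩
  have hcc : ContinuousOn c (Icc 0 1) := fun s hs => (hc s hs).continuousAt.continuousWithinAt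
  -- The distance from `c s` to `K` has lower right derivative at most `‖Y‖` times itself and starts
  -- at zero, so Gronwall keeps it zero.
  have hv := le_gronwallBound_of_liminf_deriv_right_le (f := fun s => Metric.infDist (c s) K)
    (f' := fun s => ‖Y‖ * Metric.infDist (c s) K) (δ := 0) (K := ‖Y‖) (ε := 0) (a := 0) (b := 1)
    ((Metric.continuous_infDist_pt K).comp_continuousOn hcc) ?_
    (by rw [Metric.infDist_zero_of_mem h0]) (fun s _ => by rw [add_zero])
  · intro s hs
    have h := hv s hs
    rw [gronwallBound_ε0_δ0] at h
    rw [hK.mem_iff_infDist_zero hne]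
    exact le_antisymm h Metric.infDist_nonneg
  · intro s hs r hr
    have hs' : s ∈ Icc (0 : ℝ) 1 := Ico_subset_Icc_self hs
    -- The moving point is compared with `k + h • Y k` for a nearest point `k`; the Lipschitz bound
    -- controls `Y (c s) - Y k`.
    obtain ⟨k, hkK, hk⟩ := hK.exists_infDist_eq_dist hne (c s)
    rw [dist_eq_norm] at hk
    -- One third pays for subtangentiality, one for the differentiability error of `c`, and the last
    -- keeps the inequality strict.
    have hη : 0 < (r - ‖Y‖ * Metric.infDist (c s) K) / 3 := by linarith
    set η := (r - ‖Y‖ * Metric.infDist (c s) K) / 3 with hηdef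
    have hsub : Tendsto (fun z : ℝ => z - s) (𝓝[>] s) (𝓝[>] 0) := by
      refine tendsto_nhdsWithin_iff.2 ⟨?_, ?_⟩
      · have : Tendsto (fun z : ℝ => z - s) (𝓝 s) (𝓝 (s - s)) :=
          (continuous_sub_right s).tendsto s
        rw [sub_self] at this
        exact this.mono_left nhdsWithin_le_nhds
      · filter_upwards [self_mem_nhdsWithin] with z hz
        exact mem_Ioi.2 (sub_pos.2 (mem_Ioi.1 hz))
    have e1 := hsub.eventually (hY k hkK η hη)
    have e2 : ∀ᶠ z in 𝓝[>] s, ‖c z - c s - (z - s) • Y (c s)‖ ≤ η * ‖z - s‖ :=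
      ((hasDerivAt_iff_isLittleO.1 (hc s hs')).bound hη).filter_mono nhdsWithin_le_nhds
    refine Eventually.frequently ?_
    filter_upwards [e1, e2, self_mem_nhdsWithin] with z h1 h2 hz
    have hz0 : 0 < z - s := sub_pos.2 hz
    rw [Real.norm_eq_abs, abs_of_pos hz0] at h2
    have h3 : Metric.infDist (c z) K ≤ η * (z - s) +
        (η * (z - s) + ‖c s - k‖ + (z - s) * (‖Y‖ * ‖c s - k‖)) := by
      refine Metric.infDist_le_infDist_add_dist.trans (add_le_add h1 ?_)
      rw [dist_eq_norm]
      have e : c z - (k + (z - s) • Y k) = (c z - c s - (z - s) • Y (c s)) + (c s - k) +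
          (z - s) • (Y (c s) - Y k) := by rw [smul_sub]; abel
      rw [e]
      refine (norm_add₃_le).trans (add_le_add (add_le_add h2 le_rfl) ?_)
      rw [norm_smul, Real.norm_eq_abs, abs_of_pos hz0]
      gcongr
      exact C1b.norm_sub_le Y _ _
    rw [← hk] at h3
    rw [inv_mul_lt_iff₀ hz0]
    have h4 : r = 3 * η + ‖Y‖ * Metric.infDist (c s) K := by rw [hηdef]; ring
    rw [h4]
    nlinarith

theorem IsDefiningFunction.hasDerivAt_line {S U : Set (E d)} {k : E d} {ρ : E d → ℝ}
    (hρ : IsDefiningFunction S k U ρ) (w : E d) :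
    HasDerivAt (fun h : ℝ => ρ (k + h • w)) (inner ℝ (gradient ρ k) w) 0 := by
  have hd : HasFDerivAt ρ (fderiv ℝ ρ k) k :=
    ((hρ.contDiffOn.contDiffAt (hρ.isOpen.mem_nhds hρ.mem)).differentiableAt
      (by simp)).hasFDerivAt
  have hgrad : fderiv ℝ ρ k w = inner ℝ (gradient ρ k) w := by
    rw [← toDual_gradient]; rfl
  have hline : HasDerivAt (fun h : ℝ => k + h • w) w 0 := by
    simpa using ((hasDerivAt_id (0 : ℝ)).smul_const w).const_add k
  rw [← hgrad]
  exact HasFDerivAt.comp_hasDerivAt (0 : ℝ) (by simpa using hd) hline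

theorem IsDefiningFunction.eventually_add_smul_mem {S U : Set (E d)} {k : E d} {ρ : E d → ℝ}
    (hρ : IsDefiningFunction S k U ρ) (w : E d) : ∀ᶠ h : ℝ in 𝓝[>] 0, k + h • w ∈ U := by
  have hline : Continuous fun h : ℝ => k + h • w := by fun_prop
  exact (hline.continuousAt.eventually_mem
    (by simpa using hρ.isOpen.mem_nhds hρ.mem)).filter_mono nhdsWithin_le_nhds

theorem IsDefiningFunction.eventually_mem {S U : Set (E d)} {k : E d} {ρ : E d → ℝ}
    (hρ : IsDefiningFunction S k U ρ) {w : E d} (hw : inner ℝ (gradient ρ k) w < 0) :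
    ∀ᶠ h : ℝ in 𝓝[>] 0, k + h • w ∈ S := by
  have h1 := (hρ.hasDerivAt_line w).tendsto_slope_zero_right
  filter_upwards [h1.eventually_lt_const hw, hρ.eventually_add_smul_mem w, self_mem_nhdsWithin]
    with h hh hU h0
  simp only [zero_add, zero_smul, add_zero, hρ.apply_eq_zero, sub_zero, smul_eq_mul] at hh
  exact (hρ.inter_eq.symm.subset ⟨hU, (pos_iff_neg_of_mul_neg hh).1 (inv_pos.2 h0)⟩ :
    k + h • w ∈ S ∩ U).1

/-- The derivative of `ρ` along `w` is positive, so `ρ > 0` on a whole neighbourhood of the point.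
Avoiding the closure leaves room for a bump function supported off `S`. -/
theorem IsDefiningFunction.eventually_notMem_closure {S U : Set (E d)} {k : E d} {ρ : E d → ℝ}
    (hρ : IsDefiningFunction S k U ρ) {w : E d} (hw : 0 < inner ℝ (gradient ρ k) w) :
    ∀ᶠ h : ℝ in 𝓝[>] 0, k + h • w ∉ closure S := by
  have h1 := (hρ.hasDerivAt_line w).tendsto_slope_zero_right
  filter_upwards [h1.eventually_const_lt hw, hρ.eventually_add_smul_mem w, self_mem_nhdsWithin]
    with h hh hU h0
  simp only [zero_add, zero_smul, add_zero, hρ.apply_eq_zero, sub_zero, smul_eq_mul] at hh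
  have hpos : 0 < ρ (k + h • w) := (mul_pos_iff_of_pos_left (inv_pos.2 h0)).1 hh
  have hUx : U ∈ 𝓝 (k + h • w) := hρ.isOpen.mem_nhds hU
  have hev : ∀ᶠ y in 𝓝 (k + h • w), y ∈ U ∧ 0 < ρ y :=
    (eventually_mem_set.2 hUx).and
      ((hρ.contDiffOn.continuousOn.continuousAt hUx).eventually_const_lt hpos)
  rw [mem_closure_iff_frequently]
  refine fun hfr => hfr (hev.mono fun y hy hyS => lt_asymm hy.2 ?_)
  exact (hρ.inter_eq.subset ⟨hyS, hy.1⟩ : y ∈ {x ∈ U | ρ x < 0}).2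

/-- Vectors orthogonal to the gradient of a defining function are subtangential to the boundary. -/
theorem infDist_le_of_inner_gradient_eq_zero {S U : Set (E d)} {k : E d} {ρ : E d → ℝ}
    (hρ : IsDefiningFunction S k U ρ) {v : E d} (hv : inner ℝ v (gradient ρ k) = 0) {η : ℝ}
    (hη : 0 < η) : ∀ᶠ h : ℝ in 𝓝[>] 0, Metric.infDist (k + h • v) (frontier S) ≤ η * h := by
  have hn : 0 < ‖gradient ρ k‖ := norm_pos_iff.2 (hρ.gradient_ne_zero k hρ.mem)
  set n := gradient ρ k with hn_def
  -- Tilting `v` by `±w`, of length `η`, moves the point to either side of the boundary. The segment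
  -- between the two crosses the frontier within `η h` of `k + h • v`.
  set w : E d := (η / ‖n‖) • n with hw
  have hwn : ‖w‖ = η := by
    rw [hw, norm_smul, Real.norm_eq_abs, abs_of_pos (by positivity), div_mul_cancel₀ _ hn.ne']
  have hnw : 0 < inner ℝ n w := by
    rw [hw, real_inner_smul_right, real_inner_self_eq_norm_sq]
    positivity
  have hnv : inner ℝ n v = 0 := by rw [real_inner_comm]; exact hv
  filter_upwards [hρ.eventually_notMem_closure (w := v + w)
      (by rw [inner_add_right, ← hn_def, hnv]; linarith),
    hρ.eventually_mem (w := v - w) (by rw [inner_sub_right, ← hn_def, hnv]; linarith),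
    self_mem_nhdsWithin] with h h1 hin h0
  have h0' : 0 < h := h0
  have hout : k + h • (v + w) ∉ S := fun h' => h1 (subset_closure h')
  obtain ⟨s, hs, hfr⟩ := exists_mem_frontier_of_path (S := S)
    (c := fun s : ℝ => k + h • (v + (2 * s - 1) • w)) (by fun_prop) (a := 0) (b := 1)
    (by simp) (by simp) (by simpa [sub_eq_add_neg] using hin) (by norm_num; rwa [← smul_add])
  refine (Metric.infDist_le_dist_of_mem hfr).trans ?_
  rw [dist_eq_norm]
  have e : k + h • v - (k + h • (v + (2 * s - 1) • w)) = (-(h * (2 * s - 1))) • w := by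
    rw [smul_add, smul_smul, neg_smul]; abel
  rw [e, norm_smul, hwn, norm_neg, Real.norm_eq_abs, abs_mul, abs_of_pos h0']
  have : |2 * s - 1| ≤ 1 := abs_le.2 ⟨by linarith [hs.1], by linarith [hs.2]⟩
  nlinarith [mul_pos hη h0']

end ShapeGroup

/-! ### Transported domains, and vanishing of differentials on tangential fields. -/

namespace ShapeGroup

open Set Filter Topology

variable {d : ℕ}

theorem contDiff_micheletti (F : Micheletti d) : ContDiff ℝ 1 F := by
  rw [contDiff_one_iff_hasFDerivAt]
  exact ⟨_, continuous_const.add (dev F).1.2.continuous, hasFDerivAt_micheletti F⟩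

theorem gradient_eq_zero_iff {ρ : E d → ℝ} {x : E d} : gradient ρ x = 0 ↔ fderiv ℝ ρ x = 0 := by
  rw [← toDual_gradient, LinearIsometryEquiv.map_eq_zero_iff]

theorem IsDefiningFunction.image {Ω U : Set (E d)} {p : E d} {ρ : E d → ℝ}
    (h : IsDefiningFunction Ω p U ρ) (F : Micheletti d) :
    IsDefiningFunction (F '' Ω) (F p) (F '' U) (ρ ∘ (F⁻¹ : Micheletti d)) where
  isOpen := isOpen_image F h.isOpen
  mem := mem_image_of_mem F h.mem
  contDiffOn := h.contDiffOn.comp (contDiff_micheletti F⁻¹).contDiffOn (by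
    rintro _ ⟨x, hx, rfl⟩
    rwa [inv_apply_self])
  gradient_ne_zero := by
    rintro _ ⟨x, hx, rfl⟩ h0
    have hd : DifferentiableAt ℝ (ρ ∘ (F⁻¹ : Micheletti d)) (F x) := by
      refine DifferentiableAt.comp (g := ρ) (F x) ?_
        (hasFDerivAt_micheletti F⁻¹ (F x)).differentiableAt
      rw [inv_apply_self]
      exact (h.contDiffOn.contDiffAt (h.isOpen.mem_nhds hx)).differentiableAt (by simp)
    -- Composing `ρ ∘ F⁻¹` with `F` gives `ρ` back, so a critical point at `F x` would make `x`
    -- critical for `ρ`.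
    have h1 := hd.hasFDerivAt.comp x (hasFDerivAt_micheletti F x)
    rw [gradient_eq_zero_iff.1 h0, ContinuousLinearMap.zero_comp] at h1
    have e : (ρ ∘ (F⁻¹ : Micheletti d)) ∘ F = ρ := funext fun y => congrArg ρ (inv_apply_self F y)
    rw [e] at h1
    exact h.gradient_ne_zero x hx (gradient_eq_zero_iff.2 h1.fderiv)
  apply_eq_zero := by rw [Function.comp_apply, inv_apply_self, h.apply_eq_zero]
  inter_eq := by
    ext y
    constructor
    · rintro ⟨⟨x, hx, rfl⟩, ⟨x', hx', e⟩⟩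
      obtain rfl : x' = x := F.1.injective e
      refine ⟨mem_image_of_mem F hx', ?_⟩
      rw [Function.comp_apply, inv_apply_self]
      exact (h.inter_eq.subset ⟨hx, hx'⟩ : x' ∈ {x ∈ U | ρ x < 0}).2
    · rintro ⟨⟨x, hx, rfl⟩, hρ⟩
      rw [Function.comp_apply, inv_apply_self] at hρ
      have hx2 : x ∈ Ω ∩ U := h.inter_eq.symm.subset ⟨hx, hρ⟩
      exact ⟨mem_image_of_mem F hx2.1, mem_image_of_mem F hx⟩

theorem IsC1Domain.image {Ω : Set (E d)} (h : IsC1Domain Ω) (F : Micheletti d) :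
    IsC1Domain (F '' Ω) where
  isOpen := isOpen_image F h.isOpen
  exists_defining := by
    rw [frontier_image]
    rintro _ ⟨p, hp, rfl⟩
    obtain ⟨U, ρ, hρ⟩ := h.exists_defining p hp
    exact ⟨_, _, hρ.image F⟩

/-- Where a defining function exists, the outward unit normal is a positive multiple of the
gradient of some defining function. -/
theorem exists_outerNormal_eq {S : Set (E d)} {p : E d}
    (h : ∃ ρ : E d → ℝ, ∃ U, IsDefiningFunction S p U ρ) :
    ∃ ρ U, IsDefiningFunction S p U ρ ∧ outerNormal S p = ‖gradient ρ p‖⁻¹ • gradient ρ p :=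
  ⟨h.choose, h.choose_spec.choose, h.choose_spec.choose_spec, by rw [outerNormal, dif_pos h]⟩

/-- Tangential fields on the boundary of a `C^1` domain are subtangential. -/
theorem subtangential_of_inner_outerNormal_eq_zero {S : Set (E d)} (hS : IsC1Domain S)
    {k v : E d} (hk : k ∈ frontier S) (hv : inner ℝ v (outerNormal S k) = 0) :
    ∀ η > 0, ∀ᶠ h : ℝ in 𝓝[>] 0, Metric.infDist (k + h • v) (frontier S) ≤ η * h := by
  intro η hη
  obtain ⟨U, ρ, h⟩ := hS.exists_defining k hk
  obtain ⟨ρ, U, hρ, e⟩ := exists_outerNormal_eq ⟨ρ, U, h⟩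
  refine infDist_le_of_inner_gradient_eq_zero hρ ?_ hη
  rw [e, real_inner_smul_right] at hv
  exact (mul_eq_zero.1 hv).resolve_left
    (inv_ne_zero (norm_ne_zero_iff.2 (hρ.gradient_ne_zero k hρ.mem)))

/-- The frontier is invariant under `Y` and under `-Y`. A trajectory that meets it at time `s`
therefore lies on it, first backwards to time `0`, then forwards to time `1`. -/
theorem image_eq_of_tangential_flow {S : Set (E d)} (hS : IsC1Domain S) (Y : C1b d)
    (hY : ∀ k ∈ frontier S, inner ℝ (Y k) (outerNormal S k) = 0) (G : Micheletti d) (t : ℝ)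
    (hG : ∀ x, ∃ c : ℝ → E d, c 0 = x ∧ c 1 = G x ∧
      ∀ s ∈ Icc (0 : ℝ) 1, HasDerivAt c (t • Y (c s)) s) : G '' S = S := by
  have hsub : ∀ r : ℝ, ∀ k ∈ frontier S, ∀ η > 0, ∀ᶠ h : ℝ in 𝓝[>] 0,
      Metric.infDist (k + h • (r • Y) k) (frontier S) ≤ η * h := fun r k hk =>
    subtangential_of_inner_outerNormal_eq_zero hS hk (by
      rw [C1b.smul_apply, real_inner_smul_left, hY k hk, mul_zero])
  have h0 : (0 : ℝ) ∈ Icc (0 : ℝ) 1 := by simp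
  have h1 : (1 : ℝ) ∈ Icc (0 : ℝ) 1 := by simp
  refine image_eq_of_paths hS.isOpen G fun x => ?_
  obtain ⟨c, e0, e1, hc⟩ := hG x
  refine ⟨c, fun s hs => (hc s hs).continuousAt.continuousWithinAt, e0, e1, fun s hs hcs => ?_⟩
  have hc0 : c 0 ∈ frontier S := by
    have hrev := mem_of_subtangential isClosed_frontier ((-s * t) • Y) (hsub _)
      (c := fun r => c (s * (1 - r))) (fun r hr => ?_) (by simpa using hcs) 1 h1
    · simpa using hrev
    · have hm : s * (1 - r) ∈ Icc (0 : ℝ) 1 :=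
        ⟨mul_nonneg hs.1 (by linarith [hr.2]), mul_le_one₀ hs.2 (by linarith [hr.2])
          (by linarith [hr.1])⟩
      have hl : HasDerivAt (fun r : ℝ => s * (1 - r)) (-s) r := by
        simpa using ((hasDerivAt_id r).const_sub 1).const_mul s
      have := (hc _ hm).scomp r hl
      rw [smul_smul] at this
      exact this
  exact ⟨hc0, mem_of_subtangential isClosed_frontier (t • Y) (hsub t) hc hc0 1 h1⟩

/-- If the segment from `x` to `x + t • Y x` meets the frontier, `Y` vanishes there. The Lipschitz
bound then gives `‖Y x‖ ≤ |t| ‖Y‖ ‖Y x‖`, so `Y x = 0` and the segment is a single point. -/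
theorem image_eq_of_eqOn_frontier_zero {S : Set (E d)} (hS : IsOpen S) (Y : C1b d)
    (hY : ∀ k ∈ frontier S, Y k = 0) (G : Micheletti d) (t : ℝ) (ht : |t| * ‖Y‖ < 1)
    (hG : ∀ x, G x = x + t • Y x) : G '' S = S := by
  refine image_eq_of_paths hS G fun x => ⟨fun s => x + s • (t • Y x), by fun_prop, by simp,
    by simp [hG], fun s hs hk => ?_⟩
  have h1 : Y (x + s • (t • Y x)) = 0 := hY _ hk
  have h2 : ‖Y x‖ ≤ ‖Y‖ * (|s| * (|t| * ‖Y x‖)) := by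
    have := C1b.norm_sub_le Y x (x + s • (t • Y x))
    rwa [h1, sub_zero, sub_add_cancel_left, norm_neg, norm_smul, norm_smul, Real.norm_eq_abs,
      Real.norm_eq_abs] at this
  have h3 : ‖Y x‖ = 0 := by
    have hs1 : |s| ≤ 1 := abs_le.2 ⟨by linarith [hs.1], hs.2⟩
    have h4 : ‖Y x‖ ≤ (|t| * ‖Y‖) * ‖Y x‖ := by
      refine h2.trans ?_
      have : |s| * (|t| * ‖Y x‖) ≤ |t| * ‖Y x‖ := mul_le_of_le_one_left (by positivity) hs1
      have := mul_le_mul_of_nonneg_left this (norm_nonneg Y)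
      linarith
    by_contra h5
    have h6 : 0 < ‖Y x‖ := lt_of_le_of_ne (norm_nonneg _) (Ne.symm h5)
    nlinarith
  have h4 : Y x = 0 := norm_eq_zero.1 h3
  simp only [h4, smul_zero, add_zero] at hk ⊢
  exact ⟨hk, hk⟩

/-- Multiplication of a field by a smooth cutoff function that is `1` on a compact set. -/
theorem exists_cutoff {K : Set (E d)} (hK : IsCompact K) (Y : C1b d) :
    ∃ Z : C1b d, UniformContinuous Z.1.2 ∧ ∀ k ∈ K, Z k = Y k := by
  obtain ⟨R, hR0, hR⟩ := hK.isBounded.subset_closedBall_lt 0 (0 : E d)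
  let χ : ContDiffBump (0 : E d) := ⟨R, R + 1, hR0, by linarith⟩
  have hχ : ∀ x, HasFDerivAt χ (fderiv ℝ χ x) x := fun x =>
    (χ.contDiff.differentiable (n := 1) (by simp) x).hasFDerivAt
  have hχc : Continuous (fderiv ℝ χ) := χ.contDiff.continuous_fderiv (n := 1) (by simp)
  let f : E d → E d := fun x => χ x • Y x
  let f' : E d → E d →L[ℝ] E d := fun x => χ x • Y.1.2 x + (fderiv ℝ χ x).smulRight (Y x)
  have hf : ∀ x, HasFDerivAt f (f' x) x := fun x => (hχ x).smul (Y.2 x)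
  have hfs : HasCompactSupport f := χ.hasCompactSupport.smul_right
  have hf'c : Continuous f' := by
    have hY := C1b.continuous Y
    have hY' := Y.1.2.continuous
    have hχ0 := χ.continuous
    exact (hχ0.smul hY').add (((ContinuousLinearMap.smulRightL ℝ (E d) (E d)).continuous.comp hχc).clm_apply hY)
  have hf's : HasCompactSupport f' := by
    have e : f' = fderiv ℝ f := funext fun x => (hf x).fderiv.symm
    rw [e]
    exact hfs.fderiv ℝ
  have hfc : Continuous f := continuous_iff_continuousAt.2 fun x => (hf x).continuousAt
  obtain ⟨C, hC⟩ := hfc.bounded_above_of_compact_support hfs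
  obtain ⟨C', hC'⟩ := hf'c.bounded_above_of_compact_support hf's
  refine ⟨C1b.ofBounds f f' hf hf'c C C' hC hC', hf's.uniformContinuous_of_continuous hf'c,
    fun k hk => ?_⟩
  change χ k • Y k = Y k
  rw [χ.one_of_mem_closedBall (hR hk), one_smul]

/-- Differentials of functions on the quotient vanish on tangential fields. -/
theorem differential_eq_zero_of_mem_tangentialPullback {Ω : Set (E d)} (hΩ : IsC1Domain Ω)
    (hcpt : IsCompact (frontier Ω)) (F : Micheletti d) (f : SmoothFunAt Ω (proj Ω F)) {X : C1b d}
    (hX : X ∈ tangentialPullback Ω F) : differential F f X = 0 := by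
  set Y : C1b d := precomp F⁻¹ X with hYdef
  have hK : IsCompact (frontier (F '' Ω)) := by
    rw [frontier_image]
    exact hcpt.image (continuous_micheletti F)
  have hY : ∀ k ∈ frontier (F '' Ω), inner ℝ (Y k) (outerNormal (F '' Ω) k) = 0 := by
    rw [frontier_image]
    exact hX
  -- The flow handles `Z`, whose derivative is uniformly continuous; straight lines handle `Y - Z`,
  -- which vanishes on the frontier.
  obtain ⟨Z, hZu, hZ⟩ := exists_cutoff hK Y
  have h1 : differential F f (precomp F Z) = 0 := by
    obtain ⟨G, hG0, hG, hpath⟩ := exists_flow Z hZu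
    exact differential_eq_zero_of_invariant F f G Z hG0 hG (hpath.mono fun t ht =>
      image_eq_of_tangential_flow (hΩ.image F) Z (fun k hk => by rw [hZ k hk, hY k hk]) (G t) t ht)
  have h2 : differential F f (precomp F (Y - Z)) = 0 := by
    have hz : HasDerivAt (fun t : ℝ => t • (Y - Z)) (Y - Z) 0 := by
      simpa using (hasDerivAt_id (0 : ℝ)).smul_const (Y - Z)
    have e0 : ∀ h : C1b d, h = 0 → param (1 : Micheletti d) h = 1 := fun h hh => by
      rw [hh, param_zero]
    obtain ⟨ε, hε, hex⟩ := exists_pos_forall_add_smul 1 (Y - Z)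
    have hpar : ∀ t : ℝ, |t| < ε → ∀ x, param 1 (t • (Y - Z)) x = x + t • (Y - Z) x :=
      fun t ht x => by
        obtain ⟨F', hF'⟩ := hex t ht
        have e : param 1 (t • (Y - Z)) = F' := param_eq hF'
        rw [e]
        exact hF' x
    have hev : ∀ᶠ t : ℝ in 𝓝 0, |t| < ε := by
      filter_upwards [Metric.ball_mem_nhds (0 : ℝ) hε] with t ht
      simpa using ht
    refine differential_eq_zero_of_invariant F f (fun t => param 1 (t • (Y - Z))) (Y - Z)
      (e0 _ (zero_smul ℝ _)) (hz.congr_of_eventuallyEq ?_) ?_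
    · filter_upwards [hev] with t ht
      exact dev_eq (hpar t ht)
    · have hsm : ∀ᶠ t : ℝ in 𝓝 0, |t| * ‖Y - Z‖ < 1 := by
        have h : Continuous fun t : ℝ => |t| * ‖Y - Z‖ := continuous_abs.mul continuous_const
        have h2 := h.tendsto 0
        simp only [abs_zero, zero_mul] at h2
        exact h2.eventually_lt_const one_pos
      filter_upwards [hev, hsm] with t ht ht'
      exact image_eq_of_eqOn_frontier_zero (hΩ.image F).isOpen (Y - Z)
        (fun k hk => by rw [C1b.sub_apply, hZ k hk, sub_self]) _ t ht' (hpar t ht)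
  have e : X = precomp F Z + precomp F (Y - Z) := by
    rw [← map_add, add_sub_cancel, hYdef, precomp_precomp_inv]
  rw [e, map_add, h1, h2, add_zero]

end ShapeGroup

/-! ### Smoothness of integrals over the moving shape. -/

namespace ShapeGroup

open Set Filter Topology MeasureTheory

variable {d : ℕ}

theorem contDiff_det : ContDiff ℝ ∞ (fun A : E d →L[ℝ] E d => A.det) := by
  let b := (EuclideanSpace.basisFun (Fin d) ℝ).toBasis
  have e : (fun A : E d →L[ℝ] E d => A.det) = fun A : E d →L[ℝ] E d =>
      ∑ σ : Equiv.Perm (Fin d), (Equiv.Perm.sign σ : ℤ) * ∏ i, A (b i) (σ i) := by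
    funext A
    rw [ContinuousLinearMap.det, ← LinearMap.det_toMatrix b, Matrix.det_apply']
    refine Finset.sum_congr rfl fun σ _ => ?_
    congr 1
    refine Finset.prod_congr rfl fun i _ => ?_
    rw [LinearMap.toMatrix_apply]
    simp [b]
  rw [e]
  refine ContDiff.sum fun σ _ => contDiff_const.mul (contDiff_prod fun i _ => ?_)
  exact (contDiff_euclidean.1 (contDiff_id.clm_apply contDiff_const)) (σ i)

theorem det_ne_zero (F : Micheletti d) (x : E d) :
    (ContinuousLinearMap.id ℝ (E d) + (dev F).1.2 x).det ≠ 0 := by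
  have h := (hasFDerivAt_micheletti F⁻¹ (F x)).comp x (hasFDerivAt_micheletti F x)
  have e : (F⁻¹ : Micheletti d) ∘ F = id := funext fun y => inv_apply_self F y
  rw [e] at h
  have h1 := congrArg ContinuousLinearMap.det (h.unique (hasFDerivAt_id x))
  intro h0
  have h2 : ∀ A B : E d →L[ℝ] E d, (A.comp B).det = A.det * B.det := fun A B =>
    LinearMap.det_comp (A : E d →ₗ[ℝ] E d) (B : E d →ₗ[ℝ] E d)
  rw [h2, h0, mul_zero] at h1
  exact zero_ne_one (h1.trans (LinearMap.det_id (M := E d) (A := ℝ)))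

/-- This replaces the absolute value of the Jacobian, not smooth as an expression, by a constant
sign times the determinant. -/
theorem abs_eq_sign_mul_of_ne_zero {T : Type*} [TopologicalSpace T] [PreconnectedSpace T]
    {g : T → ℝ} (hg : Continuous g) (h0 : ∀ x, g x ≠ 0) (x y : T) :
    |g x| = SignType.sign (g y) * g x := by
  have h : 0 < g x ↔ 0 < g y := by
    have key : ∀ a b, 0 < g a → 0 < g b := fun a b ha => by
      by_contra hb
      obtain ⟨c, hc⟩ := mem_range_of_exists_le_of_exists_ge hg ⟨b, not_lt.1 hb⟩ ⟨a, ha.le⟩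
      exact h0 c hc
    exact ⟨key x y, key y x⟩
  rcases lt_or_gt_of_ne (h0 y) with hy | hy
  · have hx : g x < 0 := lt_of_le_of_ne (not_lt.1 fun h' => lt_asymm hy (h.1 h')) (h0 x)
    rw [sign_neg hy, abs_of_neg hx]
    simp
  · rw [sign_pos hy, abs_of_pos (h.2 hy)]
    simp

/-- A field and its derivative, restricted to a compact set. -/
noncomputable def restrictJet (B : Set (E d)) [CompactSpace B] :
    C1b d →L[ℝ] C(B, E d × (E d →L[ℝ] E d)) :=
  LinearMap.mkContinuous
    { toFun := fun k => (⟨fun x => (k x, k.1.2 x),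
        ((C1b.continuous k).comp continuous_subtype_val).prodMk
          (k.1.2.continuous.comp continuous_subtype_val)⟩ : C(B, E d × (E d →L[ℝ] E d)))
      map_add' := fun _ _ => rfl
      map_smul' := fun _ _ => rfl } 1 fun k => by
    rw [one_mul]
    exact (ContinuousMap.norm_le _ (norm_nonneg k)).2 fun x =>
      max_le (C1b.norm_apply_le k x) (C1b.norm_fderiv_le k x)

/-- Integration against a finite measure, as a continuous linear functional. -/
noncomputable def integralFunctional {B : Type*} [TopologicalSpace B] [CompactSpace B]
    [MeasurableSpace B] [OpensMeasurableSpace B] (μ : Measure B) [IsFiniteMeasure μ] :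
    C(B, ℝ) →L[ℝ] ℝ :=
  have hi : ∀ u : C(B, ℝ), Integrable u μ := fun u =>
    Integrable.of_bound u.continuous.measurable.aestronglyMeasurable ‖u‖
      (Eventually.of_forall fun x => u.norm_coe_le_norm x)
  LinearMap.mkContinuous
    { toFun := fun u => ∫ x, u x ∂μ
      map_add' := fun u v => integral_add (hi u) (hi v)
      map_smul' := fun a _ => integral_smul a _ } (μ.real univ) fun u =>
    (norm_integral_le_of_norm_le_const (Eventually.of_forall fun x =>
      u.norm_coe_le_norm x)).trans_eq (mul_comm _ _)

/-- The integral of a test function over the shape is a smooth function near each point. -/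
theorem exists_contDiff_integral_image {Ω : Set (E d)} (hΩ : MeasurableSet Ω) {φ : E d → ℝ}
    (hφ : ContDiff ℝ ∞ φ) (hφs : HasCompactSupport φ) (F : Micheletti d) :
    ∃ J : C1b d → ℝ, ContDiff ℝ ∞ J ∧ ∀ᶠ k in 𝓝 (0 : C1b d), ∀ F' : Micheletti d,
      (∀ x, F' x = F x + k x) → ∫ y in F' '' Ω, φ y = J k := by
  obtain ⟨R, hR⟩ := hφs.isCompact.isBounded.subset_closedBall (0 : E d)
  -- If `‖k‖ < 1` and `x ∉ B`, then `F x + k x` has norm greater than `R` and `φ` vanishes there.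
  let B : Set (E d) := Metric.closedBall 0 (R + ‖dev F‖ + 1)
  have hB : MeasurableSet B := Metric.isClosed_closedBall.measurableSet
  have : CompactSpace B := isCompact_iff_compactSpace.1 (isCompact_closedBall _ _)
  let μ : Measure B := Measure.comap Subtype.val (volume.restrict Ω)
  have : IsFiniteMeasure μ := by
    refine ⟨?_⟩
    rw [comap_subtype_coe_apply hB, image_univ, Subtype.range_coe]
    exact (Measure.restrict_apply_le _ _).trans_lt
      (isCompact_closedBall (0 : E d) (R + ‖dev F‖ + 1)).measure_lt_top
  let Ψ : C(E d × (E d →L[ℝ] E d), ℝ) := ⟨fun p => φ p.1 * p.2.det,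
    (hφ.continuous.comp continuous_fst).mul (contDiff_det.continuous.comp continuous_snd)⟩
  have hΨ : ContDiff ℝ ∞ Ψ := (hφ.comp contDiff_fst).mul (contDiff_det.comp contDiff_snd)
  let u₀ : C(B, E d × (E d →L[ℝ] E d)) :=
    ⟨fun x => (F x, ContinuousLinearMap.id ℝ (E d) + (dev F).1.2 x),
      ((continuous_micheletti F).comp continuous_subtype_val).prodMk
        (continuous_const.add ((dev F).1.2.continuous.comp continuous_subtype_val))⟩
  let σ : ℝ := SignType.sign (ContinuousLinearMap.id ℝ (E d) + (dev F).1.2 0).det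
  have hJet : ContDiff ℝ ∞ fun k => restrictJet B k :=
    ContinuousLinearMap.contDiff (𝕜 := ℝ) (E := C1b d) (F := C(B, E d × (E d →L[ℝ] E d)))
      (restrictJet B)
  refine ⟨fun k => σ * integralFunctional μ (Ψ.comp (u₀ + restrictJet B k)), ?_, ?_⟩
  · exact contDiff_const.mul ((integralFunctional μ).contDiff.comp
      ((contDiff_superposition Ψ hΨ).comp (contDiff_const.add hJet)))
  obtain ⟨δ, hδ, hδF⟩ := Metric.eventually_nhds_iff.1 (eventually_exists_add F)
  filter_upwards [Metric.ball_mem_nhds (0 : C1b d) (lt_min hδ one_pos)] with k hk F' hF'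
  rw [mem_ball_zero_iff, lt_min_iff] at hk
  have hdev : ∀ x, ContinuousLinearMap.id ℝ (E d) + (dev F').1.2 x =
      ContinuousLinearMap.id ℝ (E d) + (dev F).1.2 x + k.1.2 x := fun x => by
    have e : dev F' = dev F + k := dev_eq fun x => by
      rw [hF', C1b.add_apply, ← add_assoc, ← apply_eq_add_dev]
    rw [e, add_assoc]
    rfl
  have habs : ∀ x, |(ContinuousLinearMap.id ℝ (E d) + (dev F').1.2 x).det| =
      σ * (ContinuousLinearMap.id ℝ (E d) + (dev F').1.2 x).det := fun x => by
    -- The homotopy parameter joins `F` to `F + k`. Small `k` keeps the segment in the group, so the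
    -- Jacobian never vanishes on this connected space and one sign `σ` serves all nearby maps.
    let g : E d × unitInterval → ℝ := fun p =>
      (ContinuousLinearMap.id ℝ (E d) + (dev F).1.2 p.1 + (p.2 : ℝ) • k.1.2 p.1).det
    have hg : Continuous g := by
      have h1 := (dev F).1.2.continuous
      have h2 := k.1.2.continuous
      exact contDiff_det.continuous.comp (((continuous_const.add (h1.comp continuous_fst))).add
        ((continuous_subtype_val.comp continuous_snd).smul (h2.comp continuous_fst)))
    have hg0 : ∀ p, g p ≠ 0 := fun ⟨y, τ⟩ => by
      obtain ⟨H, hH⟩ := hδF (y := (τ : ℝ) • k) (by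
        rw [dist_zero_right, norm_smul, Real.norm_eq_abs, abs_of_nonneg τ.2.1]
        exact (mul_le_of_le_one_left (norm_nonneg k) τ.2.2).trans_lt hk.1)
      have e : dev H = dev F + (τ : ℝ) • k := dev_eq fun x => by
        rw [hH, C1b.add_apply, ← add_assoc, ← apply_eq_add_dev]
      have := det_ne_zero H y
      rw [e] at this
      change (ContinuousLinearMap.id ℝ (E d) + (dev F).1.2 y + (τ : ℝ) • k.1.2 y).det ≠ 0
      rw [add_assoc]
      exact this
    have h := abs_eq_sign_mul_of_ne_zero hg hg0 (x, 1) (0, 0)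
    have e1 : g (x, 1) = (ContinuousLinearMap.id ℝ (E d) + (dev F').1.2 x).det := by
      simp [g, hdev]
    have e0 : g (0, 0) = (ContinuousLinearMap.id ℝ (E d) + (dev F).1.2 0).det := by
      have hz : ∀ A A' : E d →L[ℝ] E d, (A + (0 : ℝ) • A').det = A.det := fun A A' => by
        have h0 : (0 : ℝ) • A' = 0 := zero_smul ℝ A'
        rw [h0, add_zero]
      exact hz _ _
    rwa [e1, e0] at h
  have hout : ∀ x ∉ B, φ (F' x) = 0 := fun x hx => by
    refine image_eq_zero_of_notMem_tsupport fun h => hx ?_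
    have h1 := hR h
    rw [mem_closedBall_zero_iff] at h1 ⊢
    have h2 : x = F' x - dev F x - k x := by rw [hF', apply_eq_add_dev F]; abel
    rw [h2]
    have := norm_sub_le (F' x - dev F x) (k x)
    have := norm_sub_le (F' x) (dev F x)
    have := C1b.norm_apply_le (dev F) x
    have := C1b.norm_apply_le k x
    linarith [hk.2]
  rw [integral_image_eq_integral_abs_det_fderiv_smul volume hΩ
    (fun x _ => (hasFDerivAt_micheletti F' x).hasFDerivWithinAt) F'.1.injective.injOn,
    ← setIntegral_eq_integral_of_forall_compl_eq_zero (s := B) (fun x hx => by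
      rw [hout x hx, smul_zero]), ← integral_subtype_comap hB]
  change _ = σ * ∫ x : B, φ (F x + k x) *
    (ContinuousLinearMap.id ℝ (E d) + (dev F).1.2 x + k.1.2 x).det ∂μ
  rw [← integral_const_mul]
  refine integral_congr_ae (Eventually.of_forall fun x => ?_)
  change |(ContinuousLinearMap.id ℝ (E d) + (dev F').1.2 x).det| * φ (F' x) = _
  rw [habs, hdev, hF']
  ring

end ShapeGroup

/-! ### Integral functions on the quotient, and comparison with translations. -/

namespace ShapeGroup

open Set Filter Topology MeasureTheory

variable {d : ℕ} {Ω : Set (E d)} {p : ShapeQuotient Ω}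

theorem integral_out_image (φ : E d → ℝ) (F : Micheletti d) :
    ∫ y in (Quotient.out (proj Ω F) : Micheletti d) '' Ω, φ y = ∫ y in F '' Ω, φ y := by
  rw [proj_eq_iff.1 (Quotient.out_eq' (proj Ω F))]

/-- The smooth function `[F] ↦ ∫_{F(Ω)} φ` on the quotient, for a test function `φ`. -/
noncomputable def shapeIntegral (hΩ : MeasurableSet Ω) (p : ShapeQuotient Ω) {φ : E d → ℝ}
    (hφ : ContDiff ℝ ∞ φ) (hφs : HasCompactSupport φ) : SmoothFunAt Ω p where
  dom := univ
  toFun q := ∫ y in (Quotient.out q : Micheletti d) '' Ω, φ y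
  isOpen_dom := isOpen_univ
  mem_dom := mem_univ p
  smooth F := by
    rintro _ ⟨F₀, -, rfl⟩
    -- The formula `J` is valid only near its centre, so it is recentred at each `F₀` and shifted to
    -- the chart of `F`.
    obtain ⟨J, hJ, hJe⟩ := exists_contDiff_integral_image hΩ hφ hφs F₀
    have hJ' : ContDiff ℝ ∞ fun h : C1b d => J (h - chart F F₀) :=
      hJ.comp (contDiff_id.sub contDiff_const)
    have htend : Tendsto (fun h : C1b d => h - chart F F₀) (𝓝 (chart F F₀)) (𝓝 0) := by
      have := (continuous_sub_right (chart F F₀)).tendsto (chart F F₀)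
      rwa [sub_self] at this
    have key : ∀ᶠ h in 𝓝 (chart F F₀), ∀ F' : Micheletti d, chart F F' = h →
        ∫ y in F' '' Ω, φ y = J (h - chart F F₀) := by
      filter_upwards [htend.eventually hJe] with h hh F' hF'
      refine hh F' fun x => ?_
      rw [← hF', C1b.sub_apply, chart_apply, chart_apply]
      abel
    refine hJ'.contDiffWithinAt.congr_of_eventuallyEq ?_ ?_
    · filter_upwards [mem_nhdsWithin_of_mem_nhds key, self_mem_nhdsWithin] with h hh hm
      obtain ⟨F', -, rfl⟩ := hm
      rw [param_chart, integral_out_image]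
      exact hh F' rfl
    · rw [param_chart, integral_out_image]
      exact key.self_of_nhds F₀ rfl

theorem hasDerivAt_integral_image (hΩ : MeasurableSet Ω) {φ : E d → ℝ} (hφ : ContDiff ℝ ∞ φ)
    (hφs : HasCompactSupport φ) (F : Micheletti d) (X : C1b d) :
    HasDerivAt (fun t : ℝ => ∫ y in param F (t • X) '' Ω, φ y)
      (differential F (shapeIntegral hΩ (proj Ω F) hφ hφs) X) 0 := by
  have h1 := hasFDerivAt_localRep rfl (shapeIntegral hΩ (proj Ω F) hφ hφs)
  have hz : HasDerivAt (fun t : ℝ => t • X) X 0 := by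
    simpa using (hasDerivAt_id (0 : ℝ)).smul_const X
  have h2 := HasFDerivAt.comp_hasDerivAt (0 : ℝ) (by rw [zero_smul]; exact h1) hz
  exact h2.congr_of_eventuallyEq (Eventually.of_forall fun t => (integral_out_image φ _).symm)

/-- Constant fields. -/
noncomputable def constField (e : E d) : C1b d :=
  C1b.ofBounds (fun _ => e) (fun _ => 0) (fun x => hasFDerivAt_const e x) continuous_const ‖e‖ 0
    (fun _ => le_rfl) (fun _ => norm_zero.le)

theorem param_constField (F : Micheletti d) (e : E d) (x : E d) :
    param F (constField e) x = F x + e := by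
  let T : Micheletti d := ⟨Equiv.addRight e, ⟨constField e, fun _ => rfl⟩,
    ⟨constField (-e), fun _ => rfl⟩⟩
  have h : param F (constField e) = T * F := param_eq fun _ => rfl
  rw [h]
  rfl

theorem integral_param_constField (F : Micheletti d) (φ : E d → ℝ) (e : E d) :
    ∫ y in param F (constField e) '' Ω, φ y = ∫ y in F '' Ω, φ (y + e) := by
  have h : param F (constField e) '' Ω = (fun y => y + e) '' (F '' Ω) := by
    rw [image_image]
    exact image_congr fun x _ => param_constField F e x
  rw [h]
  exact (measurePreserving_add_right volume e).setIntegral_image_emb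
    (measurableEmbedding_addRight e) φ (F '' Ω)

theorem smul_constField (t : ℝ) (e : E d) : t • constField e = constField (t • e) :=
  C1b.ext fun _ => rfl

/-- Near a boundary point, a set moved by a field contains the translated set if the field points
further outwards than the translation. -/
theorem exists_mem_of_translate_mem {S U : Set (E d)} {p : E d} {ρ : E d → ℝ}
    (hρ : IsDefiningFunction S p U ρ) (Y : C1b d) {e : E d}
    (he : inner ℝ (gradient ρ p) e < inner ℝ (gradient ρ p) (Y p)) :
    ∃ r > (0 : ℝ), ∃ t₀ > (0 : ℝ), ∀ t ∈ Ioo 0 t₀, ∀ z, z + t • Y z ∈ Metric.ball p r →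
      z + t • Y z - t • e ∈ S → z ∈ S := by
  set n := gradient ρ p with hn
  have hU : U ∈ 𝓝 p := hρ.isOpen.mem_nhds hρ.mem
  have hgrad : ∀ w, fderiv ℝ ρ p w = inner ℝ n w := fun w => by
    rw [hn, ← toDual_gradient]; rfl
  -- Strict differentiability is needed because `z` and `z + t • Y z - t • e` both vary near `p`.
  have hstrict : HasStrictFDerivAt ρ (fderiv ℝ ρ p) p :=
    (hρ.contDiffOn.contDiffAt hU).hasStrictFDerivAt (by simp)
  -- The linear part of the change of `ρ` between the two points is at most `-t κ / 2`, against an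
  -- error of at most `t κ / 4`.
  set κ := inner ℝ n (Y p) - inner ℝ n e with hκdef
  have hκ : 0 < κ := sub_pos.2 he
  set M := ‖e‖ + ‖Y‖ + 1 with hM
  have hM0 : 0 < M := by positivity
  have hYc : ∀ᶠ z in 𝓝 p, inner ℝ n (Y p) - κ / 2 < inner ℝ n (Y z) :=
    (continuous_const.inner (C1b.continuous Y)).continuousAt.eventually_const_lt (by linarith)
  have hev := hstrict.isLittleO.bound (show 0 < κ / (4 * M) by positivity)
  rw [nhds_prod_eq, eventually_prod_self_iff'] at hev
  obtain ⟨V, hV, hVb⟩ := hev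
  obtain ⟨r, hr, hball⟩ := Metric.mem_nhds_iff.1 (inter_mem hV (inter_mem hU hYc))
  refine ⟨r / 2, by positivity, r / (2 * M), by positivity, fun t ht z hz hzS => ?_⟩
  have htM : t * M < r / 2 := by
    have := ht.2
    rw [lt_div_iff₀ (by positivity)] at this
    linarith
  rw [Metric.mem_ball, dist_eq_norm] at hz
  have hYz := C1b.norm_apply_le Y z
  have hY0 := norm_nonneg Y
  have he0 := norm_nonneg e
  have hz' : z ∈ Metric.ball p r := by
    rw [Metric.mem_ball, dist_eq_norm]
    have e1 : z - p = (z + t • Y z - p) - t • Y z := by abel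
    rw [e1]
    refine (norm_sub_le _ _).trans_lt ?_
    rw [norm_smul, Real.norm_eq_abs, abs_of_pos ht.1]
    have : t * ‖Y z‖ ≤ t * M := mul_le_mul_of_nonneg_left (by linarith) ht.1.le
    linarith
  have hb' : z + t • Y z - t • e ∈ Metric.ball p r := by
    rw [Metric.mem_ball, dist_eq_norm]
    have e1 : z + t • Y z - t • e - p = (z + t • Y z - p) - t • e := by abel
    rw [e1]
    refine (norm_sub_le _ _).trans_lt ?_
    rw [norm_smul, Real.norm_eq_abs, abs_of_pos ht.1]
    have : t * ‖e‖ ≤ t * M := mul_le_mul_of_nonneg_left (by linarith) ht.1.le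
    linarith
  have h1 := hVb z (hball hz').1 _ (hball hb').1
  have h2 : ρ (z + t • Y z - t • e) < 0 :=
    (hρ.inter_eq.subset ⟨hzS, (hball hb').2.1⟩ : _ ∈ {x ∈ U | ρ x < 0}).2
  have h3 : inner ℝ n (Y p) - κ / 2 < inner ℝ n (Y z) := (hball hz').2.2
  have e2 : z - (z + t • Y z - t • e) = t • (e - Y z) := by rw [smul_sub]; abel
  simp only [e2, hgrad, norm_smul, Real.norm_eq_abs, abs_of_pos ht.1, inner_smul_right,
    inner_sub_right] at h1
  have h4 : κ / (4 * M) * (t * ‖e - Y z‖) ≤ t * (κ / 4) := by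
    have h5 : ‖e - Y z‖ ≤ M := (norm_sub_le _ _).trans (by linarith)
    calc κ / (4 * M) * (t * ‖e - Y z‖) ≤ κ / (4 * M) * (t * M) := by
          have := ht.1.le
          gcongr
      _ = t * (κ / 4) := by field_simp
  have h6 := (abs_le.1 (h1.trans h4)).2
  have h7 : t * (inner ℝ n e - inner ℝ n (Y z)) ≤ t * (-(κ / 2)) :=
    mul_le_mul_of_nonneg_left (by linarith) ht.1.le
  have h8 : ρ z < 0 := by nlinarith [mul_pos ht.1 hκ]
  exact (hρ.inter_eq.symm.subset ⟨(hball hz').2.1, h8⟩ : z ∈ S ∩ U).1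

end ShapeGroup

/-! ### Detection of normal components, and the tangent space as a quotient. -/

namespace ShapeGroup

open Set Filter Topology MeasureTheory

variable {d : ℕ} {Ω : Set (E d)}

/-- If `X ∘ F⁻¹` points further outwards at a boundary point than the constant field `e`, then
integrals of nonnegative test functions supported near the point grow at least as fast along `X`
as along `e`. -/
theorem exists_differential_le {S U : Set (E d)} {p : E d} {ρ : E d → ℝ} (hΩ : MeasurableSet Ω)
    (F : Micheletti d) (hS : F '' Ω = S) (hρ : IsDefiningFunction S p U ρ) (X : C1b d) {e : E d}
    (he : inner ℝ (gradient ρ p) e < inner ℝ (gradient ρ p) (X (F⁻¹ p))) :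
    ∃ r > 0, ∀ (φ : E d → ℝ) (hφ : ContDiff ℝ ∞ φ) (hφs : HasCompactSupport φ), (∀ y, 0 ≤ φ y) →
      (∀ y, φ y ≠ 0 → y ∈ Metric.ball p r) →
      differential F (shapeIntegral hΩ (proj Ω F) hφ hφs) (constField e) ≤
        differential F (shapeIntegral hΩ (proj Ω F) hφ hφs) X := by
  obtain ⟨r, hr, t₀, ht₀, hmem⟩ := exists_mem_of_translate_mem hρ (precomp F⁻¹ X)
    (by rw [precomp_apply]; exact he)
  refine ⟨r, hr, fun φ hφ hφs hφ0 hφr => ?_⟩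
  obtain ⟨ε, hε, hex⟩ := exists_pos_forall_add_smul F X
  have hd := (hasDerivAt_integral_image hΩ hφ hφs F X).sub
    (hasDerivAt_integral_image hΩ hφ hφs F (constField e))
  rw [← sub_nonneg]
  refine ge_of_tendsto hd.tendsto_slope_zero_right ?_
  filter_upwards [Ioo_mem_nhdsGT (lt_min ht₀ hε)] with t ht
  obtain ⟨F', hF'⟩ := hex t (by
    rw [abs_of_pos ht.1]
    exact ht.2.trans_le (min_le_right _ _))
  have e1 : param F (t • X) = F' := param_eq hF'
  simp only [zero_add, Pi.sub_apply, zero_smul, sub_self, sub_zero, smul_eq_mul]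
  refine mul_nonneg (inv_nonneg.2 ht.1.le) (sub_nonneg.2 ?_)
  rw [e1]
  -- On the support of `φ` the translated shape lies inside the one moved by `X`. As the integrals
  -- agree at `t = 0` and `φ ≥ 0`, the right difference quotients compare.
  have hsub : Function.support φ ∩ (param F (t • constField e) '' Ω) ⊆
      Function.support φ ∩ (F' '' Ω) := by
    rintro _ ⟨hy, x, hx, rfl⟩
    refine ⟨hy, ?_⟩
    rw [smul_constField, param_constField] at hy ⊢
    set y := F x + t • e with hyd
    set w := F'⁻¹ y with hw
    have hwy : F' w = y := apply_inv_self F' y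
    have hz : F w + t • precomp F⁻¹ X (F w) = y := by
      rw [precomp_apply, inv_apply_self, ← hF', hwy]
    have hFw : F w ∈ S := by
      refine hmem t ⟨ht.1, ht.2.trans_le (min_le_left _ _)⟩ (F w) ?_ ?_
      · rw [hz]
        exact hφr y hy
      · rw [hz, hyd, add_sub_cancel_right, ← hS]
        exact mem_image_of_mem F hx
    rw [← hS] at hFw
    obtain ⟨w', hw', hww⟩ := hFw
    obtain rfl : w' = w := F.1.injective hww
    exact ⟨w, hw', hwy⟩
  have hint : Integrable φ := hφ.continuous.integrable_of_hasCompactSupport hφs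
  have hsupp : ∀ H : Micheletti d, ∫ y in H '' Ω, φ y = ∫ y in Function.support φ ∩ H '' Ω, φ y :=
    fun H => setIntegral_eq_of_subset_of_forall_sdiff_eq_zero
      (H.toHomeomorph.measurableEmbedding.measurableSet_image.2 hΩ) inter_subset_right
      fun y hy => by
        by_contra h
        exact hy.2 ⟨h, hy.1⟩
  rw [hsupp, hsupp F']
  exact setIntegral_mono_set hint.integrableOn (Eventually.of_forall hφ0) hsub.eventuallyLE

/-- Fields with nonzero normal component at a boundary point are detected by smooth functions. -/
theorem exists_differential_pos {S U : Set (E d)} {p : E d} {ρ : E d → ℝ} (hΩ : IsOpen Ω)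
    (F : Micheletti d) (hS : F '' Ω = S) (hρ : IsDefiningFunction S p U ρ) (X : C1b d)
    (hX : 0 < inner ℝ (gradient ρ p) (X (F⁻¹ p))) :
    ∃ f : SmoothFunAt Ω (proj Ω F), 0 < differential F f X := by
  set n := gradient ρ p with hn
  have hn0 : 0 < ‖n‖ := norm_pos_iff.2 (hρ.gradient_ne_zero p hρ.mem)
  set a := inner ℝ n (X (F⁻¹ p)) with ha
  -- The factor makes the component of `e` along `n` half that of `X ∘ F⁻¹`: still outward, but
  -- strictly smaller.
  set e : E d := (a / (2 * ‖n‖ ^ 2)) • n with he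
  have hne : inner ℝ n e = a / 2 := by
    rw [he, real_inner_smul_right, real_inner_self_eq_norm_sq]
    field_simp
  obtain ⟨r, hr, hcmp⟩ := exists_differential_le hΩ.measurableSet F hS hρ X (e := e) (by
    rw [← hn, hne]; linarith)
  have hout := hρ.eventually_notMem_closure (w := e) (by rw [← hn, hne]; linarith)
  have hin := hρ.eventually_mem (w := -e) (by rw [← hn, inner_neg_right, hne]; linarith)
  have hsm : ∀ᶠ s : ℝ in 𝓝[>] 0, s * ‖e‖ < r / 2 := by
    have h : Continuous fun s : ℝ => s * ‖e‖ := continuous_id.mul continuous_const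
    have h2 := h.tendsto 0
    simp only [zero_mul] at h2
    exact (h2.eventually_lt_const (by positivity)).filter_mono nhdsWithin_le_nhds
  obtain ⟨s₀, h1, h2, h3, hs₀⟩ := (hout.and (hin.and (hsm.and self_mem_nhdsWithin))).exists
  have hs₀ : 0 < s₀ := hs₀
  have hSo : IsOpen S := hS ▸ isOpen_image F hΩ
  obtain ⟨δ₁, hδ₁, hb₁⟩ := Metric.isOpen_iff.1 isClosed_closure.isOpen_compl _ h1
  obtain ⟨δ₂, hδ₂, hb₂⟩ := Metric.isOpen_iff.1 hSo _ h2
  -- The bump fits outside `S` around `p + s₀ • e` and inside `S` around `p - s₀ • e`. The bound `r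
  -- / 2` keeps all intermediate translates supported in the ball of radius `r`.
  set δ := min (min δ₁ δ₂) (r / 2) with hδ
  have hδ0 : 0 < δ := lt_min (lt_min hδ₁ hδ₂) (by positivity)
  let φ : ContDiffBump p := ⟨δ / 2, δ, by positivity, by linarith⟩
  have hφs : ∀ y, φ y ≠ 0 → ‖y - p‖ < δ := fun y hy => by
    have h : y ∈ Metric.ball p δ := φ.support_eq.subset hy
    rwa [Metric.mem_ball, dist_eq_norm] at h
  have hc : ∀ s : ℝ, ContDiff ℝ ∞ fun y => φ (y + s • e) := fun s =>
    φ.contDiff.comp (contDiff_id.add contDiff_const)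
  have hcs : ∀ s : ℝ, HasCompactSupport fun y => φ (y + s • e) := fun s =>
    φ.hasCompactSupport.comp_homeomorph (Homeomorph.addRight (s • e))
  let g : ℝ → ℝ := fun s => ∫ y in S, φ (y + s • e)
  have hg : ∀ s, HasDerivAt g (differential F (shapeIntegral hΩ.measurableSet (proj Ω F) (hc s) (hcs s))
      (constField e)) s := fun s => by
    have h := hasDerivAt_integral_image hΩ.measurableSet (hc s) (hcs s) F (constField e)
    have e1 : (fun t : ℝ => ∫ y in param F (t • constField e) '' Ω, φ (y + s • e)) =
        fun t => g (s + t) := funext fun t => by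
      rw [smul_constField, integral_param_constField F (fun y => φ (y + s • e)), hS]
      simp only [g, add_smul, add_assoc, add_comm (s • e)]
    rw [e1] at h
    have h' := HasDerivAt.comp_sub_const s s (by rw [sub_self]; exact h)
    simpa only [add_sub_cancel] using h'
  have hpos : 0 < g s₀ := by
    have e1 : g s₀ = ∫ y, φ (y + s₀ • e) :=
      setIntegral_eq_integral_of_forall_compl_eq_zero fun y hy => by
        by_contra h
        refine hy (hb₂ ?_)
        rw [Metric.mem_ball, dist_eq_norm]
        have := (hφs _ h).trans_le ((min_le_left _ _).trans (min_le_right _ _))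
        have e2 : y - (p + s₀ • -e) = y + s₀ • e - p := by rw [smul_neg]; abel
        rwa [e2]
    rw [e1, integral_add_right_eq_self (fun y => φ y)]
    exact φ.integral_pos
  have hzero : g (-s₀) = 0 := setIntegral_eq_zero_of_forall_eq_zero fun y hy => by
    by_contra h
    refine hb₁ (a := y) ?_ (subset_closure hy)
    rw [Metric.mem_ball, dist_eq_norm]
    have := (hφs _ h).trans_le ((min_le_left _ _).trans (min_le_left _ _))
    have e2 : y - (p + s₀ • e) = y + -s₀ • e - p := by rw [neg_smul]; abel
    rwa [e2]
  -- The mean value theorem selects the translate of the bump whose integral strictly grows along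
  -- `e`.
  obtain ⟨s, hs, hslope⟩ := exists_hasDerivAt_eq_slope g _ (neg_lt_self hs₀)
    (fun s _ => (hg s).continuousAt.continuousWithinAt) (fun s _ => hg s)
  refine ⟨shapeIntegral hΩ.measurableSet (proj Ω F) (hc s) (hcs s), lt_of_lt_of_le ?_
    (hcmp _ (hc s) (hcs s) (fun y => φ.nonneg) fun y hy => ?_)⟩
  · rw [hslope, hzero, sub_zero]
    exact div_pos hpos (by linarith)
  · rw [Metric.mem_ball, dist_eq_norm]
    have h4 := (hφs _ hy).trans_le (min_le_right _ _)
    have e1 : y - p = (y + s • e - p) - s • e := by abel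
    have h5 : |s| ≤ s₀ := abs_le.2 ⟨hs.1.le, hs.2.le⟩
    rw [e1]
    refine (norm_sub_le _ _).trans_lt ?_
    rw [norm_smul, Real.norm_eq_abs]
    have : |s| * ‖e‖ ≤ s₀ * ‖e‖ := mul_le_mul_of_nonneg_right h5 (norm_nonneg e)
    linarith

/-- The tangential fields are exactly those annihilated by all differentials. -/
theorem mem_tangentialPullback_iff (hΩ : IsC1Domain Ω) (hcpt : IsCompact (frontier Ω))
    (F : Micheletti d) (X : C1b d) :
    X ∈ tangentialPullback Ω F ↔ ∀ f : SmoothFunAt Ω (proj Ω F), differential F f X = 0 := by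
  refine ⟨fun hX f => differential_eq_zero_of_mem_tangentialPullback hΩ hcpt F f hX,
    fun h y hy => ?_⟩
  by_contra hne
  rw [← frontier_image] at hy
  obtain ⟨U, ρ, hρ⟩ := (hΩ.image F).exists_defining y hy
  obtain ⟨ρ, U, hρ, e⟩ := exists_outerNormal_eq ⟨ρ, U, hρ⟩
  rw [e, real_inner_smul_right, real_inner_comm] at hne
  rcases lt_or_gt_of_ne (right_ne_zero_of_mul hne) with hlt | hgt
  · obtain ⟨f, hf⟩ := exists_differential_pos hΩ.isOpen F rfl hρ (-X) (by
      rw [C1b.neg_apply, inner_neg_right]; linarith)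
    rw [map_neg, h f, neg_zero] at hf
    exact lt_irrefl _ hf
  · obtain ⟨f, hf⟩ := exists_differential_pos hΩ.isOpen F rfl hρ X hgt
    rw [h f] at hf
    exact lt_irrefl _ hf

/-- The tangent vector of the line with a given velocity, on normal classes. -/
noncomputable def lineTangent (hΩ : IsC1Domain Ω) (hcpt : IsCompact (frontier Ω))
    (F : Micheletti d) (v : PullbackNormalClasses Ω F) : QuotientTangent Ω (proj Ω F) :=
  Quotient.liftOn' v (fun X => (lineCurve Ω F X).tangent) fun X X' h => Quotient.sound fun f => by
    have h1 : X - X' ∈ tangentialPullback Ω F := (Submodule.quotientRel_def _).1 h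
    have h2 := (mem_tangentialPullback_iff hΩ hcpt F _).1 h1 f
    rw [map_sub, sub_eq_zero] at h2
    rw [derivAlong_lineCurve, derivAlong_lineCurve, h2]

theorem act_lineTangent (hΩ : IsC1Domain Ω) (hcpt : IsCompact (frontier Ω))
    (F : Micheletti d) (X : C1b d) (f : SmoothFunAt Ω (proj Ω F)) :
    (lineTangent hΩ hcpt F (pullbackClass Ω F X)).act f = differential F f X :=
  derivAlong_lineCurve F X f

/-- Injectivity says that the common kernel contains only tangential fields; surjectivity, that
every curve is equivalent to a line through `F`. -/
theorem bijective_lineTangent (hΩ : IsC1Domain Ω) (hcpt : IsCompact (frontier Ω))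
    (F : Micheletti d) : Function.Bijective (lineTangent hΩ hcpt F) := by
  constructor
  · intro v w h
    obtain ⟨X, rfl⟩ := (tangentialPullback Ω F).mkQ_surjective v
    obtain ⟨X', rfl⟩ := (tangentialPullback Ω F).mkQ_surjective w
    refine (Submodule.Quotient.eq _).2 ((mem_tangentialPullback_iff hΩ hcpt F _).2 fun f => ?_)
    have h1 := congrArg (fun u => QuotientTangent.act u f) h
    have h2 : differential F f X = differential F f X' :=
      (act_lineTangent hΩ hcpt F X f).symm.trans (h1.trans (act_lineTangent hΩ hcpt F X' f))
    rw [map_sub, h2, sub_self]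
  · intro u
    obtain ⟨γ, rfl⟩ := Quotient.exists_rep u
    obtain ⟨X, hX⟩ := exists_derivAlong_eq F γ
    refine ⟨pullbackClass Ω F X, Quotient.sound fun f => ?_⟩
    rw [derivAlong_lineCurve, hX]

/-- Composition with the inverse transformation, as a linear automorphism of `C^1_b`. -/
noncomputable def precompInvEquiv (F : Micheletti d) : C1b d ≃ₗ[ℝ] C1b d :=
  LinearEquiv.ofLinearMap (precompₗ F⁻¹) (precompₗ F)
    (LinearMap.ext fun X => precomp_inv_precomp F X)
    (LinearMap.ext fun X => precomp_precomp_inv F X)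

theorem map_tangentialPullback (Ω : Set (E d)) (F : Micheletti d) :
    (tangentialPullback Ω F).map (precompInvEquiv F : C1b d →ₗ[ℝ] C1b d) =
      tangentialFields Ω F := by
  ext Y
  constructor
  · rintro ⟨X, hX, rfl⟩
    exact hX
  · intro hY
    refine ⟨precomp F Y, fun y hy => ?_, precomp_inv_precomp F Y⟩
    rw [precomp_apply, apply_inv_self]
    exact hY y hy

end ShapeGroup

theorem mainTheorem5 (d : ℕ) (Ω : Set (ShapeGroup.E d)) (hΩ : ShapeGroup.IsC1Domain Ω)
    (hcpt : IsCompact (frontier Ω)) (F : ShapeGroup.Micheletti d) :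
    (∃ e : ShapeGroup.QuotientTangent Ω (ShapeGroup.proj Ω F) ≃
          ShapeGroup.PullbackNormalClasses Ω F,
      (∀ γ : ShapeGroup.CurveAt Ω (ShapeGroup.proj Ω F), γ.toFun 0 = F →
        e γ.tangent = ShapeGroup.pullbackClass Ω F γ.velocity) ∧
      (∀ (a b : ℝ) (v w : ShapeGroup.PullbackNormalClasses Ω F)
          (f : ShapeGroup.SmoothFunAt Ω (ShapeGroup.proj Ω F)),
        (e.symm (a • v + b • w)).act f = a * (e.symm v).act f + b * (e.symm w).act f)) ∧
    (∃ e' : ShapeGroup.PullbackNormalClasses Ω F ≃ₗ[ℝ] ShapeGroup.NormalClasses Ω F,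
      ∀ X Y : ShapeGroup.C1b d, (∀ y, Y y = X (F⁻¹ y)) →
        e' (ShapeGroup.pullbackClass Ω F X) = ShapeGroup.normalClass Ω F Y) := by
  -- The required bijection is the inverse of `lineTangent`. Its linearity is that of `differential
  -- F f` in the field, and the second isomorphism is induced by `X ↦ X ∘ F⁻¹`.
  refine ⟨⟨(Equiv.ofBijective _ (ShapeGroup.bijective_lineTangent hΩ hcpt F)).symm,
    fun γ hγ => ?_, fun a b v w f => ?_⟩,
    Submodule.Quotient.equiv _ _ (ShapeGroup.precompInvEquiv F)
      (ShapeGroup.map_tangentialPullback Ω F), fun X Y h => ?_⟩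
  · rw [Equiv.symm_apply_eq]
    refine Quotient.sound fun f => ?_
    rw [ShapeGroup.derivAlong_lineCurve, ShapeGroup.CurveAt.derivAlong_eq, hγ]
  · obtain ⟨X, rfl⟩ := (ShapeGroup.tangentialPullback Ω F).mkQ_surjective v
    obtain ⟨X', rfl⟩ := (ShapeGroup.tangentialPullback Ω F).mkQ_surjective w
    rw [← map_smul, ← map_smul, ← map_add]
    have h := fun Z => ShapeGroup.act_lineTangent hΩ hcpt F Z f
    refine (h _).trans ?_
    rw [map_add, map_smul, map_smul, ← h X, ← h X']
    rfl
  · have e : Y = ShapeGroup.precomp F⁻¹ X := ShapeGroup.C1b.ext h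
    rw [e]
    rfl
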